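/- **Setting.** Let $\mathcal A=\{1,\dots,K\}$. Let $(X_t,(Y_t(a))_{a\in\mathcal A})$, $t\ge 1$, with $X_t\in\mathbb R^d$ and $Y_t(a)\in\mathbb R$, be i.i.d. copies of $(X,(Y(a))_{a\in\mathcal A})\sim\mathcal P$. At each round $t$ the pair $(X_t,(Y_t(a))_a)$ is drawn independently of the past history $\mathcal H_{t-1}=\{X_\tau,\pi_\tau,A_\tau,Y_\tau\}_{\tau<t}$; then an action $A_t\in\mathcal A$ is drawn with conditional probabilities $\mathbb P(A_t=a\mid \mathcal H_{t-1},X_t)=\pi_t(a):=\pi_t(a\mid X_t,\mathcal H_{t-1})$ given by a behavior policy, the realized selection probability $\pi_t(A_t)$ is recorded as $\pi_t$, and $Y_t=Y_t(A_t)$ is observed. Assume unconfoundedness: $A_t\perp (Y_t(a))_{a\in\mathcal A}\mid(\mathcal H_{t-1},X_t)$ for all $t$. For each $a$ let $\theta_a^*\in\mathbb R^d$ be the best linear projection parameter, i.e. the solution of $\mathbb E[X(Y(a)-X^\top\theta_a^*)]=0$. **Assumptions.** (i) $\|X\|_2\le M$ almost surely for some constant $M$, $\Sigma_X=\mathbb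 E[XX^\top]$ is invertible, and $\mathbb E[Y(a)^4]<\infty$ for every $a$. (ii) The behavior policy converges to a stationary policy $\bar\pi:\mathbb R^d\to\Delta(\mathcal A)$, where $\Delta(\mathcal A)$ is the set of probability distributions on $\mathcal A$: for every $a$, $\pi_t(a\mid X_t,\mathcal H_{t-1})-\bar\pi(a\mid X_t)\to 0$ in probability as $t\to\infty$. (iii) There is a constant $\pi_{\min}\in(0,1)$ with $\pi_t(a\mid X_t,\mathcal H_{t-1})\ge\pi_{\min}$ almost surely for all $t$ and $a$. **Conclusion.** For every $a$ the matrix $$\Sigma_a^*=\Sigma_X^{-1}\,\mathbb E\!\left[\frac{(Y(a)-X^\top\theta_a^*)^2}{\bar\pi(a\mid X)}XX^\top\right]\Sigma_X^{-1}$$ is well defined (the expectation is finite) and positive semidefinite. The inverse-probability-weighted least squares estimators $$\hat\theta_a^{(T)}=\Big(\frac1T\sum_{t=1}^T\frac{1_{\{A_t=a\}}}{\pi_t(A_t)}X_tX_t^\top\Big)^{-1}\Big(\frac1T\sum_{t=1}^T\frac{1_{\{A_t=a\}}}{\pi_t(A_t)}X_tY_t\Big)$$ (with the inverse read as the zero matrix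 when the matrix is singular, here and below) satisfy, for every $a$, the estimating equation $$\frac1T\sum_{t=1}^T\frac{1_{\{A_t=a\}}}{\pi_t(A_t)}X_t\big(Y_t-X_t^\top\hat\theta_a^{(T)}\big)=o_p(1/\sqrt T).$$ Moreover, for any estimators $\hat\theta_a^{(T)}$, $a\in\mathcal A$, that satisfy this estimating equation for every $a$, in particular for the least squares estimators, the following hold as $T\to\infty$. 1. With $\hat\theta^{(T)}$ and $\theta^*$ the vectors obtained by stacking $\hat\theta_a^{(T)}$ and $\theta_a^*$ over $a\in\mathcal A$, $\sqrt T(\hat\theta^{(T)}-\theta^*)\xrightarrow{d}\mathcal N\big(0,\mathrm{diag}(\Sigma_1^*,\dots,\Sigma_K^*)\big)$ (block diagonal). 2. For every $a$, $\hat G_{a,T}^{-1}\,\hat I_{a,T}\,(\hat G_{a,T}^{-1})^\top\to\Sigma_a^*$ in probability, where $$\hat G_{a,T}=\frac1T\sum_{t=1}^T\frac{1_{\{A_t=a\}}}{\pi_t(A_t)}X_tX_t^\top,\qquad \hat I_{a,T}=\frac1T\sum_{t=1}^T\frac{1_{\{A_t=a\}}}{\pi_t(A_t)^2}(Y_t-X_t^\top\hat\theta_a^{(T)})^2X_tX_t^\top.$$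 -/

import Mathlib

open MeasureTheory ProbabilityTheory Filter Topology
open scoped Matrix

noncomputable section

namespace AdaptiveBandit

/-- Contexts live in Euclidean space `ℝ^d`. -/
abbrev Ctx (d : ℕ) : Type := EuclideanSpace ℝ (Fin d)

/-- A recorded observation `(X_t, π_t, A_t, Y_t)`: the context, the realized selection probability,
the selected action and the observed outcome. The action set is `Fin K`. -/
abbrev Obs (d K : ℕ) : Type := Ctx d × ℝ × Fin K × ℝ

/-- The environment at one time: a context together with the potential outcomes of all actions. -/
abbrev Env (d K : ℕ) : Type := Ctx d × (Fin K → ℝ)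

/-- A behavior policy. For the round with index `t` (rounds are numbered from `0`, so that `t`
rounds precede it), `prob t h x a` is the probability of selecting action `a` given the past `h`
and the current context `x`. -/
structure BehaviorPolicy (d K : ℕ) where
  prob : (t : ℕ) → (Fin t → Obs d K) → Ctx d → Fin K → ℝ
  mem_simplex : ∀ t h x, prob t h x ∈ stdSimplex ℝ (Fin K)
  measurable_prob : ∀ t, Measurable fun q : (Fin t → Obs d K) × Ctx d => prob t q.1 q.2

/-- A stationary policy: action probabilities that depend on the current context only. -/
structure StationaryPolicy (d K : ℕ) where
  prob : Ctx d → Fin K → ℝ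
  mem_simplex : ∀ x, prob x ∈ stdSimplex ℝ (Fin K)
  measurable_prob : Measurable prob

/-- The random variables of a bandit experiment: contexts `X t`, potential outcomes `Ypot t ω a`,
actions `A t`, and recorded selection probabilities `p t`. -/
structure BanditData (d K : ℕ) (Ω : Type*) where
  X : ℕ → Ω → Ctx d
  Ypot : ℕ → Ω → Fin K → ℝ
  A : ℕ → Ω → Fin K
  p : ℕ → Ω → ℝ

namespace BanditData

variable {d K : ℕ} {Ω : Type*}

/-- The observed outcome is the potential outcome of the selected action. -/
def Y (D : BanditData d K Ω) (t : ℕ) (ω : Ω) : ℝ := D.Ypot t ω (D.A t ω)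

/-- Context and potential outcomes at round `t`. -/
def env (D : BanditData d K Ω) (t : ℕ) (ω : Ω) : Env d K := (D.X t ω, D.Ypot t ω)

/-- The history before round `t`: everything recorded in the rounds `τ < t`. -/
def hist (D : BanditData d K Ω) (t : ℕ) (ω : Ω) : Fin t → Obs d K :=
  fun τ => (D.X τ ω, D.p τ ω, D.A τ ω, D.Y τ ω)

/-- The sigma-algebra generated by the history before round `t` and the context of round `t`. -/
abbrev infoAlg (D : BanditData d K Ω) (t : ℕ) : MeasurableSpace Ω :=
  MeasurableSpace.comap (fun ω => (D.hist t ω, D.X t ω)) inferInstance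

end BanditData

/-- Conditional independence of `U` and `V` given the sub-sigma-algebra `m`, through conditional
probabilities (so that no regularity of the sample space is needed). -/
def CondIndepGiven {Ω β γ : Type*} (m : MeasurableSpace Ω) [mΩ : MeasurableSpace Ω]
    [MeasurableSpace β] [MeasurableSpace γ] (U : Ω → β) (V : Ω → γ) (μ : Measure Ω) : Prop :=
  ∀ (s : Set β) (t : Set γ), MeasurableSet s → MeasurableSet t →
    μ[(U ⁻¹' s ∩ V ⁻¹' t).indicator (fun _ => (1 : ℝ)) | m] =ᵐ[μ]
      fun ω => (μ[(U ⁻¹' s).indicator (fun _ => (1 : ℝ)) | m]) ω *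
        (μ[(V ⁻¹' t).indicator (fun _ => (1 : ℝ)) | m]) ω

variable {d K : ℕ} {Ω : Type*} [MeasurableSpace Ω]

/-- The data `D` are collected by the behavior policy `π` in the stochastic contextual bandit
environment with law `P`: the environment variables are i.i.d. with law `P`, those of a round are
drawn independently of the history before it, the action is selected with the probabilities given
by the policy at the current history and context, and the selection probability of the chosen
action is recorded. -/
structure IsBanditProcess (μ : Measure Ω) (P : Measure (Env d K)) (π : BehaviorPolicy d K)
    (D : BanditData d K Ω) : Prop where
  measurable_X : ∀ t, Measurable (D.X t)
  measurable_Ypot : ∀ t, Measurable (D.Ypot t)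
  measurable_A : ∀ t, Measurable (D.A t)
  measurable_p : ∀ t, Measurable (D.p t)
  env_law : ∀ t, μ.map (D.env t) = P
  env_indep : iIndepFun D.env μ
  env_indep_hist : ∀ t, IndepFun (D.env t) (D.hist t) μ
  action_law : ∀ t a,
    μ[(D.A t ⁻¹' {a}).indicator (fun _ => (1 : ℝ)) | D.infoAlg t] =ᵐ[μ]
      fun ω => π.prob t (D.hist t ω) (D.X t ω) a
  recorded : ∀ t ω, D.p t ω = π.prob t (D.hist t ω) (D.X t ω) (D.A t ω)

/-- Unconfoundedness: the action is independent of the potential outcomes of the same round,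
conditionally on the history and the context. -/
def Unconfounded (μ : Measure Ω) (D : BanditData d K Ω) : Prop :=
  ∀ t, CondIndepGiven (D.infoAlg t) (D.A t) (D.Ypot t) μ

/-- The behavior policy converges to the stationary policy `πbar`: for every action,
`π_t(a | X_t, H_{t-1}) - πbar(a | X_t)` tends to `0` in probability. -/
def PolicyConverges (μ : Measure Ω) (π : BehaviorPolicy d K) (D : BanditData d K Ω)
    (πbar : StationaryPolicy d K) : Prop :=
  ∀ a, TendstoInMeasure μ
    (fun t ω => π.prob t (D.hist t ω) (D.X t ω) a - πbar.prob (D.X t ω) a) atTop (fun _ => 0)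

/-- Minimum sampling probability, for every action. -/
def MinSampling (μ : Measure Ω) (π : BehaviorPolicy d K) (D : BanditData d K Ω) : Prop :=
  ∃ πmin : ℝ, 0 < πmin ∧ πmin < 1 ∧
    ∀ t a, ∀ᵐ ω ∂μ, πmin ≤ π.prob t (D.hist t ω) (D.X t ω) a

/-- The least squares score `g(x, y; θ) = x (y - xᵀ θ)`. -/
def score (x : Ctx d) (y : ℝ) (θ : Ctx d) : Ctx d := (y - inner ℝ x θ) • x

/-- `θ a` is the target parameter of every action `a`: it solves `E g(X, Y(a); θ a) = 0`. -/
def IsTarget (P : Measure (Env d K)) (θ : Fin K → Ctx d) : Prop :=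
  ∀ a, ∫ z, score z.1 (z.2 a) (θ a) ∂P = 0

/-- The second moment matrix `E[X Xᵀ]` of the context. -/
def sigmaX (P : Measure (Env d K)) : Matrix (Fin d) (Fin d) ℝ :=
  Matrix.of fun i j => ∫ z, z.1 i * z.1 j ∂P

/-- The `(i, j)` entry of `(Y(a) - Xᵀ θ)² / πbar(a | X) * X Xᵀ`. -/
def meatEntry (πbar : StationaryPolicy d K) (a : Fin K) (θ : Ctx d) (i j : Fin d)
    (z : Env d K) : ℝ :=
  (z.2 a - inner ℝ z.1 θ) ^ 2 / πbar.prob z.1 a * (z.1 i * z.1 j)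

/-- The asymptotic covariance of arm `a`,
`E[X Xᵀ]⁻¹ E[(Y(a) - Xᵀ θ)² / πbar(a | X) * X Xᵀ] E[X Xᵀ]⁻¹`. -/
def asympCov (P : Measure (Env d K)) (πbar : StationaryPolicy d K) (a : Fin K) (θ : Ctx d) :
    Matrix (Fin d) (Fin d) ℝ :=
  (sigmaX P)⁻¹ * (Matrix.of fun i j => ∫ z, meatEntry πbar a θ i j z ∂P) * (sigmaX P)⁻¹

/-- The inverse probability weight `1{A_t = a} / π_t(A_t)`. -/
def weight (D : BanditData d K Ω) (a : Fin K) (t : ℕ) (ω : Ω) : ℝ :=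
  if D.A t ω = a then (D.p t ω)⁻¹ else 0

/-- The weighted score `T⁻¹ ∑ 1{A_t = a} / π_t(A_t) * g(X_t, Y_t; θ)` over the first `T` rounds. -/
def estEq (D : BanditData d K Ω) (a : Fin K) (T : ℕ) (ω : Ω) (θ : Ctx d) : Ctx d :=
  (T : ℝ)⁻¹ • ∑ t ∈ Finset.range T, weight D a t ω • score (D.X t ω) (D.Y t ω) θ

/-- `T⁻¹ ∑ 1{A_t = a} / π_t(A_t) * X_t X_tᵀ`. -/
def gramHat (D : BanditData d K Ω) (a : Fin K) (T : ℕ) (ω : Ω) : Matrix (Fin d) (Fin d) ℝ :=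
  (T : ℝ)⁻¹ • ∑ t ∈ Finset.range T,
    weight D a t ω • Matrix.vecMulVec (D.X t ω).ofLp (D.X t ω).ofLp

/-- The inverse-probability-weighted least squares estimator
`(T⁻¹ ∑ 1{A_t = a} / π_t(A_t) X_t X_tᵀ)⁻¹ (T⁻¹ ∑ 1{A_t = a} / π_t(A_t) X_t Y_t)`. -/
def ipwLS (D : BanditData d K Ω) (a : Fin K) (T : ℕ) (ω : Ω) : Ctx d :=
  WithLp.toLp 2 ((gramHat D a T ω)⁻¹ *ᵥ
    ((T : ℝ)⁻¹ • ∑ t ∈ Finset.range T, (weight D a t ω * D.Y t ω) • (D.X t ω).ofLp))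

/-- `T⁻¹ ∑ 1{A_t = a} / π_t(A_t)² * (Y_t - X_tᵀ θ)² X_t X_tᵀ`. -/
def meatHat (D : BanditData d K Ω) (a : Fin K) (T : ℕ) (ω : Ω) (θ : Ctx d) :
    Matrix (Fin d) (Fin d) ℝ :=
  (T : ℝ)⁻¹ • ∑ t ∈ Finset.range T,
    (weight D a t ω ^ 2 * (D.Y t ω - inner ℝ (D.X t ω) θ) ^ 2) •
      Matrix.vecMulVec (D.X t ω).ofLp (D.X t ω).ofLp

/-- The plug-in variance estimator, evaluated at the parameter estimate `θ`. -/
def covHat (D : BanditData d K Ω) (a : Fin K) (T : ℕ) (ω : Ω) (θ : Ctx d) :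
    Matrix (Fin d) (Fin d) ℝ :=
  (gramHat D a T ω)⁻¹ * meatHat D a T ω θ * ((gramHat D a T ω)⁻¹)ᵀ

/-- Estimators `θhat T a` of all arms that solve the weighted estimating equation up to
`o_p(1 / √T)`. -/
def IsIPWZEstimator (μ : Measure Ω) (D : BanditData d K Ω)
    (θhat : ℕ → Fin K → Ω → Ctx d) : Prop :=
  (∀ T a, AEMeasurable (θhat T a) μ) ∧
    ∀ a, TendstoInMeasure μ
      (fun (T : ℕ) ω => √(T : ℝ) • estEq D a T ω (θhat T a ω)) atTop (fun _ => 0)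

/-- The vectors `v a` of all arms stacked into one vector; the coordinate `(i, a)` is `v a i`. -/
def stack (v : Fin K → Ctx d) : EuclideanSpace ℝ (Fin d × Fin K) :=
  WithLp.toLp 2 fun q => v q.2 q.1

end AdaptiveBandit

end

/-! For a fixed arm write Ψ(η) for `estEq` and G for `gramHat`. Since Ψ is affine in η with slope
−G, wherever G is invertible θ̂ − θ = G⁻¹(Ψ(θ) − Ψ(θ̂)) (`sub_eq_inv_mulVec`). So everything reduces
to a law of large numbers for weighted averages, which gives G → Σ_X and Ψ(θ) → 0, and a central
limit theorem for √T Ψ(θ).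

The probabilistic core is a change of measure. By unconfoundedness, restricting to {A_t = a} has the
same effect on the joint law of history, context and potential outcomes as the density π_t(a)
(`map_restrict_action`). Hence under the integral the weight to the power k + 1 acts as π_t(a)⁻ᵏ
(`integral_weight_pow_smul`). For k = 0 the policy disappears, so weighted centered scores are
martingale differences. For k = 1 a factor 1/π_t(a) remains. The lower bound on the policy, its
convergence, and the independence of the round from the history allow it to be replaced by 1/π̄(a)
up to a vanishing error (`norm_integral_weight_sub_smul_le`).

That one estimate is used twice. Tested against earlier summands it bounds correlations, and second
moments give the law of large numbers (`tendstoInMeasure_weighted_average`). Tested against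
characters of the partial sums it gives the central limit theorem by telescoping characteristic
functions (`tendsto_integral_cexp_weighted_sum`). The limit covariance is block diagonal because a
round gives weight to one arm only, so products of summands of different arms vanish.

Slutsky's theorem then transfers normality from √T Ψ(θ) to any approximate solution. The variance
estimator is a polynomial in the estimation error whose coefficients are weighted averages at the
true parameter, so no uniform law of large numbers is needed. -/

noncomputable section

set_option linter.unusedSectionVars false

namespace AdaptiveBandit

/-! ### Calculus of convergence in measure to constants. -/

section Convergence

variable {Ω ι : Type*} [MeasurableSpace Ω] {μ : Measure Ω} {l : Filter ι}

/-- Continuous mapping theorem for convergence in measure to a constant. -/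
lemma tendstoInMeasure_comp_continuousAt {E F : Type*} [PseudoEMetricSpace E]
    [PseudoEMetricSpace F] {f : ι → Ω → E} {c : E} {g : E → F}
    (hf : TendstoInMeasure μ f l (fun _ => c)) (hg : ContinuousAt g c) :
    TendstoInMeasure μ (fun n ω => g (f n ω)) l (fun _ => g c) := by
  intro ε hε
  obtain ⟨δ, hδ, h⟩ := EMetric.tendsto_nhds_nhds.1 hg ε hε
  refine tendsto_of_tendsto_of_tendsto_of_le_of_le tendsto_const_nhds (hf δ hδ)
    (fun _ => zero_le) fun n => measure_mono fun ω hω => ?_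
  by_contra hlt
  exact absurd (h (not_le.1 hlt)) (not_lt.2 hω)

/-- A sup-distance of at least ε is attained in some coordinate, so a finite union bound suffices; ε
> 0 rules out the empty index type. -/
lemma tendstoInMeasure_pi {κ : Type*} [Fintype κ] {E : κ → Type*}
    [∀ k, PseudoEMetricSpace (E k)] {f : ι → Ω → ∀ k, E k} {c : ∀ k, E k}
    (hf : ∀ k, TendstoInMeasure μ (fun n ω => f n ω k) l (fun _ => c k)) :
    TendstoInMeasure μ f l (fun _ => c) := by
  intro ε hε
  have hsum : Tendsto (fun n => ∑ k, μ {ω | ε ≤ edist (f n ω k) (c k)}) l (𝓝 0) := by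
    simpa using tendsto_finsetSum Finset.univ fun k _ => hf k ε hε
  refine tendsto_of_tendsto_of_tendsto_of_le_of_le tendsto_const_nhds hsum
    (fun _ => zero_le) fun n => ?_
  refine (measure_mono fun ω hω => ?_).trans (measure_iUnion_fintype_le μ _)
  by_contra hlt
  simp only [Set.mem_iUnion, Set.mem_ofPred_eq, not_exists, not_le] at hlt hω
  have h0 : (⊥ : ENNReal) < ε := hε
  exact absurd hω (not_le.2 ((Finset.sup_lt_iff h0).2 fun k _ => hlt k))

lemma tendstoInMeasure_prodMk {E F : Type*} [PseudoEMetricSpace E] [PseudoEMetricSpace F]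
    {f : ι → Ω → E} {g : ι → Ω → F} {c : E} {d : F}
    (hf : TendstoInMeasure μ f l (fun _ => c)) (hg : TendstoInMeasure μ g l (fun _ => d)) :
    TendstoInMeasure μ (fun n ω => (f n ω, g n ω)) l (fun _ => (c, d)) := by
  intro ε hε
  have hsum : Tendsto (fun n => μ {ω | ε ≤ edist (f n ω) c} + μ {ω | ε ≤ edist (g n ω) d})
      l (𝓝 0) := by
    simpa using (hf ε hε).add (hg ε hε)
  refine tendsto_of_tendsto_of_tendsto_of_le_of_le tendsto_const_nhds hsum
    (fun _ => zero_le) fun n => ?_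
  refine (measure_mono fun ω hω => ?_).trans (measure_union_le _ _)
  simpa [Prod.edist_eq, le_max_iff] using hω

/-- Convergence in measure is insensitive to modifications on events of vanishing measure. -/
lemma tendstoInMeasure_of_eq_off {E : Type*} [PseudoEMetricSpace E] {f g : ι → Ω → E}
    {c : Ω → E} {B : ι → Set Ω} (hf : TendstoInMeasure μ f l c)
    (hB : Tendsto (fun n => μ (B n)) l (𝓝 0)) (hfg : ∀ n ω, ω ∉ B n → f n ω = g n ω) :
    TendstoInMeasure μ g l c := by
  intro ε hε
  have hsum := (hf ε hε).add hB
  rw [add_zero] at hsum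
  refine tendsto_of_tendsto_of_tendsto_of_le_of_le tendsto_const_nhds hsum
    (fun _ => zero_le) fun n => ?_
  refine (measure_mono fun ω hω => ?_).trans (measure_union_le _ _)
  by_cases h : ω ∈ B n
  · exact Or.inr h
  · left
    simpa [hfg n ω h] using hω

end Convergence

/-! ### Abstract weak law and central limit theorem for dependent summands. -/

section LimitTheorems

variable {Ω : Type*} [MeasurableSpace Ω] {μ : Measure Ω} [IsProbabilityMeasure μ]

/-- Weak law of large numbers for square integrable variables whose correlations with the past
vanish asymptotically. -/
lemma tendstoInMeasure_average {η : ℕ → Ω → ℝ} (hη : ∀ t, MemLp (η t) 2 μ) {C : ℝ}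
    (hC : ∀ t, ∫ ω, η t ω ^ 2 ∂μ ≤ C) {ε : ℕ → ℝ} (hε : Tendsto ε atTop (𝓝 0))
    (hcorr : ∀ s t, s < t → |∫ ω, η s ω * η t ω ∂μ| ≤ ε t) :
    TendstoInMeasure μ (fun (T : ℕ) ω => (T : ℝ)⁻¹ * ∑ t ∈ Finset.range T, η t ω) atTop
      (fun _ => 0) := by
  have hint : ∀ s t, Integrable (fun ω => η s ω * η t ω) μ :=
    fun s t => (hη s).integrable_mul (hη t)
  have hS : ∀ T, MemLp (fun ω => ∑ t ∈ Finset.range T, η t ω) 2 μ :=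
    fun T => memLp_finsetSum _ fun t _ => hη t
  -- Expanding the square one summand at a time, the cross term of the new summand with the t
  -- earlier ones is at most t · ε t.
  have hbound : ∀ T : ℕ, ∫ ω, (∑ t ∈ Finset.range T, η t ω) ^ 2 ∂μ ≤
      ∑ t ∈ Finset.range T, (C + 2 * (t * ε t)) := by
    intro T
    induction T with
    | zero => simp
    | succ T ih =>
      have hcross : ∫ ω, (∑ t ∈ Finset.range T, η t ω) * η T ω ∂μ ≤ T * ε T := by
        simp_rw [Finset.sum_mul]
        rw [integral_finsetSum _ fun t _ => hint t T]
        calc ∑ t ∈ Finset.range T, ∫ ω, η t ω * η T ω ∂μ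
            ≤ ∑ t ∈ Finset.range T, ε T := Finset.sum_le_sum fun t ht =>
              (le_abs_self _).trans (hcorr t T (Finset.mem_range.1 ht))
          _ = T * ε T := by simp
      have hexp : ∀ ω, (∑ t ∈ Finset.range (T + 1), η t ω) ^ 2 =
          (∑ t ∈ Finset.range T, η t ω) ^ 2 + 2 * ((∑ t ∈ Finset.range T, η t ω) * η T ω) +
            η T ω ^ 2 := by
        intro ω
        rw [Finset.sum_range_succ]
        ring
      simp_rw [hexp]
      have i1 : Integrable (fun ω => (∑ t ∈ Finset.range T, η t ω) ^ 2) μ := (hS T).integrable_sq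
      have i2 : Integrable (fun ω => 2 * ((∑ t ∈ Finset.range T, η t ω) * η T ω)) μ :=
        ((hS T).integrable_mul (hη T)).const_mul 2
      rw [integral_add (i1.fun_add i2) (hη T).integrable_sq, integral_add i1 i2,
        integral_const_mul, Finset.sum_range_succ]
      linarith [hC T]
  have hεabs : Tendsto (fun t => |ε t|) atTop (𝓝 0) := by simpa using hε.abs
  have hlim : Tendsto (fun T : ℕ => (C * (T : ℝ)⁻¹ +
      2 * ((T : ℝ)⁻¹ * ∑ t ∈ Finset.range T, |ε t|))) atTop (𝓝 0) := by
    have h1 := (tendsto_inv_atTop_nhds_zero_nat (𝕜 := ℝ)).const_mul C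
    have h2 := hεabs.cesaro.const_mul 2
    simpa using h1.add h2
  have hL2 : ∀ T : ℕ, ∫ ω, ((T : ℝ)⁻¹ * ∑ t ∈ Finset.range T, η t ω) ^ 2 ∂μ ≤
      C * (T : ℝ)⁻¹ + 2 * ((T : ℝ)⁻¹ * ∑ t ∈ Finset.range T, |ε t|) := by
    intro T
    rcases Nat.eq_zero_or_pos T with rfl | hT
    · simp
    have hT' : (0 : ℝ) < T := by exact_mod_cast hT
    simp_rw [mul_pow]
    rw [integral_const_mul]
    -- Bounding t by T turns the cross terms, after division by T², into a Cesàro mean of |ε|.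
    have h2 : ∑ t ∈ Finset.range T, (C + 2 * (t * ε t)) ≤
        T * C + 2 * (T * ∑ t ∈ Finset.range T, |ε t|) := by
      rw [Finset.sum_add_distrib, ← Finset.mul_sum, Finset.mul_sum (Finset.range T) _ (T : ℝ)]
      simp only [Finset.sum_const, Finset.card_range, nsmul_eq_mul]
      refine add_le_add le_rfl (mul_le_mul_of_nonneg_left ?_ zero_le_two)
      refine Finset.sum_le_sum fun t ht => ?_
      calc (t : ℝ) * ε t ≤ t * |ε t| := mul_le_mul_of_nonneg_left (le_abs_self _) t.cast_nonneg
        _ ≤ T * |ε t| := mul_le_mul_of_nonneg_right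
            (by exact_mod_cast (Finset.mem_range.1 ht).le) (abs_nonneg _)
    calc ((T : ℝ)⁻¹) ^ 2 * ∫ ω, (∑ t ∈ Finset.range T, η t ω) ^ 2 ∂μ
        ≤ ((T : ℝ)⁻¹) ^ 2 * (T * C + 2 * (T * ∑ t ∈ Finset.range T, |ε t|)) :=
          mul_le_mul_of_nonneg_left ((hbound T).trans h2) (by positivity)
      _ = _ := by field_simp
  rw [tendstoInMeasure_iff_measureReal_norm]
  intro δ hδ
  have hlim' := hlim.div_const (δ ^ 2)
  rw [zero_div] at hlim'
  refine tendsto_of_tendsto_of_tendsto_of_le_of_le tendsto_const_nhds hlim'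
    (fun _ => measureReal_nonneg) fun T => ?_
  have hmk := mul_meas_ge_le_integral_of_nonneg (μ := μ)
    (f := fun ω => ((T : ℝ)⁻¹ * ∑ t ∈ Finset.range T, η t ω) ^ 2)
    (ae_of_all _ fun ω => sq_nonneg _) ((hS T).const_mul _).integrable_sq (δ ^ 2)
  simp only
  rw [le_div_iff₀ (by positivity), mul_comm]
  refine le_trans (le_of_eq ?_) (hmk.trans (hL2 T))
  congr 2
  ext ω
  simp only [sub_zero, Set.mem_ofPred_eq, Real.norm_eq_abs]
  rw [← sq_abs ((T : ℝ)⁻¹ * _), pow_le_pow_iff_left₀ hδ.le (abs_nonneg _) two_ne_zero]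

/-- For |x| ≤ 1 this is the Taylor remainder with e ≤ 4. For |x| ≥ 1 each of the terms 1, 1, |x| and
x²/2 is at most a multiple of |x|³, and the multiples add up to 7/2. The bound holds for all x, so
third moments suffice and no truncation is required. -/
lemma norm_cexp_mul_I_sub_taylor_le (x : ℝ) :
    ‖Complex.exp (x * Complex.I) - (1 + x * Complex.I - x ^ 2 / 2)‖ ≤ 4 * |x| ^ 3 := by
  rcases le_total |x| 1 with hx | hx
  · have h := Complex.norm_exp_sub_sum_le_norm_mul_exp (x * Complex.I) 3
    have he : Real.exp |x| ≤ 4 := by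
      have := Real.exp_le_exp.2 hx
      linarith [Real.exp_one_lt_d9]
    have hsum : ∑ m ∈ Finset.range 3, ((x : ℂ) * Complex.I) ^ m / (m.factorial : ℂ) =
        1 + x * Complex.I - x ^ 2 / 2 := by
      simp [Finset.sum_range_succ, mul_pow]
      ring
    rw [hsum] at h
    refine h.trans ?_
    simp only [norm_mul, Complex.norm_real, Complex.norm_I, mul_one, Real.norm_eq_abs]
    nlinarith [pow_nonneg (abs_nonneg x) 3]
  · have h1 : ‖Complex.exp (x * Complex.I)‖ = 1 := Complex.norm_exp_ofReal_mul_I x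
    have h2 : ‖(1 + x * Complex.I - x ^ 2 / 2 : ℂ)‖ ≤ 1 + |x| + |x| ^ 2 / 2 := by
      refine (norm_sub_le _ _).trans ?_
      refine add_le_add ((norm_add_le _ _).trans ?_) ?_
      · simp
      · simp
    refine (norm_sub_le _ _).trans ?_
    rw [h1]
    have h3 : |x| ≤ |x| ^ 3 := le_self_pow₀ hx (by norm_num)
    have h4 : |x| ^ 2 ≤ |x| ^ 3 := pow_le_pow_right₀ hx (by norm_num)
    nlinarith [h2]

/-- The exponential lies between 1 − x and 1/(1 + x) ≤ 1 − x + x². -/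
lemma abs_exp_neg_sub_le {x : ℝ} (hx : 0 ≤ x) : |Real.exp (-x) - (1 - x)| ≤ x ^ 2 := by
  have h1 : 1 - x ≤ Real.exp (-x) := by linarith [Real.add_one_le_exp (-x)]
  rw [abs_of_nonneg (by linarith)]
  have h2 : Real.exp (-x) ≤ (1 + x)⁻¹ := by
    rw [Real.exp_neg]
    exact inv_anti₀ (by positivity) (by linarith [Real.add_one_le_exp x])
  have h3 : (1 + x)⁻¹ ≤ 1 - x + x ^ 2 := by
    rw [inv_le_iff_one_le_mul₀ (by positivity)]
    nlinarith [pow_nonneg hx 3]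
  linarith

/-- Central limit theorem for martingale-type arrays, in terms of characteristic functions: the
increments have vanishing conditional means, and conditional variances that converge to `σ2`,
both tested against characters of the partial sums. -/
lemma tendsto_integral_cexp_inv_sqrt_mul_sum {ξ : ℕ → Ω → ℝ}
    (hm : ∀ t, AEMeasurable (ξ t) μ)
    (h3 : ∀ t, Integrable (fun ω => |ξ t ω| ^ 3) μ) (h2i : ∀ t, Integrable (fun ω => ξ t ω ^ 2) μ)
    (h1i : ∀ t, Integrable (ξ t) μ) {C : ℝ} (hC : ∀ t, ∫ ω, |ξ t ω| ^ 3 ∂μ ≤ C) {σ2 : ℝ}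
    (hσ : 0 ≤ σ2) {ε : ℕ → ℝ} (hε : Tendsto ε atTop (𝓝 0))
    (hmean : ∀ (t : ℕ) (c : ℝ),
      ∫ ω, Complex.exp ((c * ∑ s ∈ Finset.range t, ξ s ω : ℝ) * Complex.I) * ξ t ω ∂μ = 0)
    (hvar : ∀ (t : ℕ) (c : ℝ),
      ‖∫ ω, Complex.exp ((c * ∑ s ∈ Finset.range t, ξ s ω : ℝ) * Complex.I) *
        ((ξ t ω ^ 2 - σ2 : ℝ) : ℂ) ∂μ‖ ≤ ε t) :
    Tendsto (fun T : ℕ => ∫ ω, Complex.exp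
      (((√(T : ℝ))⁻¹ * ∑ s ∈ Finset.range T, ξ s ω : ℝ) * Complex.I) ∂μ) atTop
      (𝓝 (Real.exp (-(σ2 / 2)) : ℂ)) := by
  set U : ℝ → ℕ → Ω → ℂ := fun c t ω =>
    Complex.exp ((c * ∑ s ∈ Finset.range t, ξ s ω : ℝ) * Complex.I) with hU
  have hUn : ∀ c t ω, ‖U c t ω‖ = 1 := fun c t ω => Complex.norm_exp_ofReal_mul_I _
  have hUm : ∀ c t, AEStronglyMeasurable (U c t) μ := by
    intro c t
    have : AEMeasurable (fun ω => ∑ s ∈ Finset.range t, ξ s ω) μ :=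
      Finset.aemeasurable_fun_sum _ fun s _ => hm s
    exact (by fun_prop : AEMeasurable (U c t) μ).aestronglyMeasurable
  have hUi : ∀ c t {f : Ω → ℂ}, Integrable f μ → Integrable (fun ω => U c t ω * f ω) μ :=
    fun c t f hf => hf.bdd_mul (hUm c t) (ae_of_all _ fun ω => (hUn c t ω).le)
  -- One summand multiplies the characteristic function by ρ = exp(−σ²r²/2) up to three errors: the
  -- conditional variance, the cubic Taylor remainder, and ρ versus 1 − σ²r²/2. The linear term
  -- vanishes by `hmean`.
  have hstep : ∀ (r : ℝ), 0 ≤ r → ∀ t,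
      ‖∫ ω, U r (t + 1) ω ∂μ - Real.exp (-(σ2 * r ^ 2 / 2)) * ∫ ω, U r t ω ∂μ‖ ≤
        r ^ 2 / 2 * ε t + 4 * r ^ 3 * C + (σ2 * r ^ 2 / 2) ^ 2 := by
    intro r hr t
    set ρ : ℝ := Real.exp (-(σ2 * r ^ 2 / 2)) with hρ
    set R : Ω → ℂ := fun ω => Complex.exp ((r * ξ t ω : ℝ) * Complex.I) -
      (1 + (r * ξ t ω : ℝ) * Complex.I - ((r * ξ t ω : ℝ) : ℂ) ^ 2 / 2) with hR
    set ρ' : ℝ := ρ - (1 - σ2 * r ^ 2 / 2) with hρ'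
    have hsplit : ∀ ω, U r (t + 1) ω - ρ * U r t ω =
        (r * Complex.I) * (U r t ω * ξ t ω) -
          (r ^ 2 / 2 : ℝ) * (U r t ω * ((ξ t ω ^ 2 - σ2 : ℝ) : ℂ)) + U r t ω * R ω -
          ρ' * U r t ω := by
      intro ω
      have : U r (t + 1) ω = U r t ω * Complex.exp ((r * ξ t ω : ℝ) * Complex.I) := by
        simp only [hU]
        rw [← Complex.exp_add, Finset.sum_range_succ]
        congr 1
        push_cast
        ring
      rw [this, hR, hρ']
      push_cast
      ring
    have hRi : Integrable R μ := by
      refine Integrable.mono' ((h3 t).const_mul (4 * r ^ 3)) ?_ (ae_of_all _ fun ω => ?_)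
      · have := hm t
        exact (by fun_prop : AEMeasurable R μ).aestronglyMeasurable
      · refine (norm_cexp_mul_I_sub_taylor_le _).trans (le_of_eq ?_)
        rw [abs_mul, abs_of_nonneg hr]
        ring
    have iU : ∀ s, Integrable (U r s) μ := fun s => by
      simpa using hUi r s (integrable_const (1 : ℂ))
    have i1 : Integrable (fun ω => (r * Complex.I) * (U r t ω * ξ t ω)) μ :=
      (hUi r t (h1i t).ofReal).const_mul _
    have i2 : Integrable (fun ω => ((r ^ 2 / 2 : ℝ) : ℂ) *
        (U r t ω * ((ξ t ω ^ 2 - σ2 : ℝ) : ℂ))) μ :=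
      (hUi r t ((h2i t).sub (integrable_const σ2)).ofReal).const_mul _
    have i3 : Integrable (fun ω => U r t ω * R ω) μ := hUi r t hRi
    have i4 : Integrable (fun ω => (ρ' : ℂ) * U r t ω) μ := (iU t).const_mul _
    have i12 : Integrable (fun ω => (r * Complex.I) * (U r t ω * ξ t ω) -
        ((r ^ 2 / 2 : ℝ) : ℂ) * (U r t ω * ((ξ t ω ^ 2 - σ2 : ℝ) : ℂ))) μ := i1.sub i2
    rw [← integral_const_mul, ← integral_sub (iU _) ((iU _).const_mul _)]
    simp_rw [hsplit]
    rw [integral_sub (i12.fun_add i3) i4, integral_add i12 i3, integral_sub i1 i2,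
      integral_const_mul, integral_const_mul, integral_const_mul, hmean t r, mul_zero, zero_sub]
    refine (norm_sub_le _ _).trans (add_le_add ((norm_add_le _ _).trans (add_le_add ?_ ?_)) ?_)
    · rw [norm_neg, norm_mul, Complex.norm_real, Real.norm_of_nonneg (by positivity)]
      exact mul_le_mul_of_nonneg_left (hvar t r) (by positivity)
    · refine (norm_integral_le_integral_norm _).trans ?_
      calc ∫ ω, ‖U r t ω * R ω‖ ∂μ ≤ ∫ ω, 4 * r ^ 3 * |ξ t ω| ^ 3 ∂μ := by
            refine integral_mono i3.norm ((h3 t).const_mul _) fun ω => ?_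
            simp only [norm_mul, hUn, one_mul]
            refine (norm_cexp_mul_I_sub_taylor_le _).trans (le_of_eq ?_)
            rw [abs_mul, abs_of_nonneg hr]
            ring
        _ ≤ _ := by
            rw [integral_const_mul]
            exact mul_le_mul_of_nonneg_left (hC t) (by positivity)
    · rw [norm_mul, Complex.norm_real, Real.norm_eq_abs]
      have h1 : ‖∫ ω, U r t ω ∂μ‖ ≤ 1 := by
        refine (norm_integral_le_integral_norm _).trans ?_
        simp [hUn]
      have h2 : |ρ'| ≤ (σ2 * r ^ 2 / 2) ^ 2 := abs_exp_neg_sub_le (by positivity)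
      calc |ρ'| * ‖∫ ω, U r t ω ∂μ‖ ≤ (σ2 * r ^ 2 / 2) ^ 2 * 1 :=
            mul_le_mul h2 h1 (norm_nonneg _) (by positivity)
        _ = _ := mul_one _
  -- Since ρ ≤ 1, one-step errors are not amplified and simply add up.
  have htel : ∀ (r : ℝ), 0 ≤ r → ∀ t,
      ‖∫ ω, U r t ω ∂μ - (Real.exp (-(σ2 * r ^ 2 / 2)) : ℂ) ^ t‖ ≤
        ∑ s ∈ Finset.range t, (r ^ 2 / 2 * ε s + 4 * r ^ 3 * C + (σ2 * r ^ 2 / 2) ^ 2) := by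
    intro r hr t
    induction t with
    | zero => simp [hU]
    | succ t ih =>
      rw [Finset.sum_range_succ, add_comm (Finset.sum _ _)]
      have heq : ∫ ω, U r (t + 1) ω ∂μ - (Real.exp (-(σ2 * r ^ 2 / 2)) : ℂ) ^ (t + 1) =
          (∫ ω, U r (t + 1) ω ∂μ - Real.exp (-(σ2 * r ^ 2 / 2)) * ∫ ω, U r t ω ∂μ) +
          Real.exp (-(σ2 * r ^ 2 / 2)) *
            (∫ ω, U r t ω ∂μ - (Real.exp (-(σ2 * r ^ 2 / 2)) : ℂ) ^ t) := by
        ring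
      rw [heq]
      refine (norm_add_le _ _).trans (add_le_add (hstep r hr t) ?_)
      rw [norm_mul, Complex.norm_real, Real.norm_of_nonneg (Real.exp_pos _).le]
      refine le_trans (mul_le_of_le_one_left (norm_nonneg _) ?_) ih
      exact Real.exp_le_one_iff.2 (by simp only [Left.neg_nonpos_iff]; positivity)
  rw [tendsto_iff_norm_sub_tendsto_zero]
  have hlim : Tendsto (fun T : ℕ => 2⁻¹ * ((T : ℝ)⁻¹ * ∑ s ∈ Finset.range T, ε s) +
      4 * C * √((T : ℝ)⁻¹) + σ2 ^ 2 / 4 * (T : ℝ)⁻¹) atTop (𝓝 0) := by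
    have h0 := tendsto_inv_atTop_nhds_zero_nat (𝕜 := ℝ)
    have h1 := (hε.cesaro).const_mul (2 : ℝ)⁻¹
    have h2 := (h0.sqrt).const_mul (4 * C)
    have h4 := h0.const_mul (σ2 ^ 2 / 4)
    simpa using (h1.add h2).add h4
  refine squeeze_zero' (Eventually.of_forall fun _ => norm_nonneg _) ?_ hlim
  filter_upwards [eventually_gt_atTop 0] with T hT
  have hT' : (0 : ℝ) < T := by exact_mod_cast hT
  -- With r = 1/√T, the T steps cost half a Cesàro mean of ε, plus terms of order T⁻¹ᐟ² and T⁻¹,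
  -- while ρ^T is exactly the Gaussian value.
  have h := htel (√(T : ℝ))⁻¹ (by positivity) T
  have hr2 : ((√(T : ℝ))⁻¹) ^ 2 = (T : ℝ)⁻¹ := by rw [inv_pow, Real.sq_sqrt hT'.le]
  have hpow : (Real.exp (-(σ2 * ((√(T : ℝ))⁻¹) ^ 2 / 2)) : ℂ) ^ T =
      (Real.exp (-(σ2 / 2)) : ℂ) := by
    rw [← Complex.ofReal_pow, ← Real.exp_nat_mul, hr2]
    congr 2
    field_simp
  rw [hpow] at h
  refine h.trans (le_of_eq ?_)
  have hr3 : ((√(T : ℝ))⁻¹) ^ 3 = (T : ℝ)⁻¹ * √((T : ℝ)⁻¹) := by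
    rw [pow_succ, hr2, Real.sqrt_inv]
  rw [Finset.sum_add_distrib, Finset.sum_add_distrib, ← Finset.mul_sum, hr2, hr3]
  simp only [Finset.sum_const, Finset.card_range, nsmul_eq_mul]
  field_simp
  ring

end LimitTheorems

/-! ### Change of measure by the selection probability, and convergence of the policy. -/

section

variable {d K : ℕ} {Ω : Type*} [MeasurableSpace Ω]

/-- The probability with which the behavior policy selects `a` at round `t`, as a random variable. -/
def selProb (π : BehaviorPolicy d K) (D : BanditData d K Ω) (t : ℕ) (a : Fin K) (ω : Ω) : ℝ :=
  π.prob t (D.hist t ω) (D.X t ω) a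

/-- The inverse probability weight of arm `a`, as a function of the recorded observation. -/
def obsWeight (a : Fin K) (o : Obs d K) : ℝ := if o.2.2.1 = a then (o.2.1)⁻¹ else 0

lemma measurable_obsWeight (a : Fin K) : Measurable (obsWeight a : Obs d K → ℝ) := by
  refine Measurable.ite ?_ (by fun_prop) measurable_const
  exact (measurableSet_singleton a).preimage (by fun_prop)

namespace IsBanditProcess

variable {μ : Measure Ω} [IsProbabilityMeasure μ] {P : Measure (Env d K)}
  {π : BehaviorPolicy d K} {D : BanditData d K Ω}

lemma measurable_Y (hD : IsBanditProcess μ P π D) (t : ℕ) : Measurable (D.Y t) := by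
  have h1 := hD.measurable_Ypot t
  have h2 := hD.measurable_A t
  have heq : D.Y t = fun ω => ∑ a, if D.A t ω = a then D.Ypot t ω a else 0 := by
    ext ω
    simp [BanditData.Y]
  rw [heq]
  refine Finset.measurable_sum _ fun a _ => Measurable.ite ?_ (by fun_prop) measurable_const
  exact h2 (measurableSet_singleton a)

lemma measurable_env (hD : IsBanditProcess μ P π D) (t : ℕ) : Measurable (D.env t) :=
  (hD.measurable_X t).prodMk (hD.measurable_Ypot t)

lemma measurable_hist (hD : IsBanditProcess μ P π D) (t : ℕ) : Measurable (D.hist t) :=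
  measurable_pi_lambda _ fun τ => (hD.measurable_X τ).prodMk
    ((hD.measurable_p τ).prodMk ((hD.measurable_A τ).prodMk (hD.measurable_Y τ)))

lemma measurable_weight (hD : IsBanditProcess μ P π D) (a : Fin K) (t : ℕ) :
    Measurable (weight D a t) :=
  (measurable_obsWeight a).comp ((hD.measurable_X t).prodMk
    ((hD.measurable_p t).prodMk ((hD.measurable_A t).prodMk (hD.measurable_Y t))))

lemma infoAlg_le (hD : IsBanditProcess μ P π D) (t : ℕ) : D.infoAlg t ≤ ‹MeasurableSpace Ω› :=
  ((hD.measurable_hist t).prodMk (hD.measurable_X t)).comap_le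

lemma measurable_selProb_infoAlg (t : ℕ) (a : Fin K) :
    Measurable[D.infoAlg t] (selProb π D t a) := by
  have h : Measurable fun q : (Fin t → Obs d K) × Ctx d => π.prob t q.1 q.2 a :=
    (measurable_pi_apply a).comp (π.measurable_prob t)
  exact h.comp (comap_measurable _)

lemma measurable_selProb (hD : IsBanditProcess μ P π D) (t : ℕ) (a : Fin K) :
    Measurable (selProb π D t a) :=
  (measurable_selProb_infoAlg t a).mono (hD.infoAlg_le t) le_rfl

lemma selProb_nonneg (t : ℕ) (a : Fin K) (ω : Ω) : 0 ≤ selProb π D t a ω :=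
  (π.mem_simplex t _ _).1 a

lemma selProb_le_one (t : ℕ) (a : Fin K) (ω : Ω) : selProb π D t a ω ≤ 1 :=
  (mem_Icc_of_mem_stdSimplex (π.mem_simplex t (D.hist t ω) (D.X t ω)) a).2

lemma isProbabilityMeasure (hD : IsBanditProcess μ P π D) : IsProbabilityMeasure P := by
  rw [← hD.env_law 0]
  exact Measure.isProbabilityMeasure_map (hD.measurable_env 0).aemeasurable

lemma integral_env (hD : IsBanditProcess μ P π D) (t : ℕ) {f : Env d K → ℝ} (hf : Measurable f) :
    ∫ ω, f (D.env t ω) ∂μ = ∫ z, f z ∂P := by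
  rw [← hD.env_law t, integral_map (hD.measurable_env t).aemeasurable hf.aestronglyMeasurable]

lemma integrable_env (hD : IsBanditProcess μ P π D) (t : ℕ) {f : Env d K → ℝ}
    (hf : Integrable f P) : Integrable (fun ω => f (D.env t ω)) μ := by
  rw [← hD.env_law t] at hf
  exact hf.comp_measurable (hD.measurable_env t)

lemma ae_env (hD : IsBanditProcess μ P π D) (t : ℕ) {p : Env d K → Prop}
    (hp : ∀ᵐ z ∂P, p z) : ∀ᵐ ω ∂μ, p (D.env t ω) := by
  rw [← hD.env_law t] at hp
  exact ae_of_ae_map (hD.measurable_env t).aemeasurable hp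

/-- On the event of selecting `a`, the joint law of history, context and potential outcomes has
the selection probability as its density. -/
lemma map_restrict_action (hD : IsBanditProcess μ P π D) (hunc : Unconfounded μ D) (t : ℕ)
    (a : Fin K) :
    (μ.restrict (D.A t ⁻¹' {a})).map (fun ω => ((D.hist t ω, D.X t ω), D.Ypot t ω)) =
      (μ.withDensity fun ω => ENNReal.ofReal (selProb π D t a ω)).map
        (fun ω => ((D.hist t ω, D.X t ω), D.Ypot t ω)) := by
  have hI : Measurable fun ω => (D.hist t ω, D.X t ω) :=
    (hD.measurable_hist t).prodMk (hD.measurable_X t)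
  have hY := hD.measurable_Ypot t
  have hle := hD.infoAlg_le t
  refine Measure.ext_prod fun {s u} hs hu => ?_
  have hA : MeasurableSet (D.A t ⁻¹' {a}) := hD.measurable_A t (measurableSet_singleton a)
  have hU : MeasurableSet (D.Ypot t ⁻¹' u) := hY hu
  have hS : MeasurableSet[D.infoAlg t] ((fun ω => (D.hist t ω, D.X t ω)) ⁻¹' s) := ⟨s, hs, rfl⟩
  have hpre : (fun ω => ((D.hist t ω, D.X t ω), D.Ypot t ω)) ⁻¹' (s ×ˢ u) =
      ((fun ω => (D.hist t ω, D.X t ω)) ⁻¹' s) ∩ D.Ypot t ⁻¹' u := rfl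
  rw [Measure.map_apply (hI.prodMk hY) (hs.prod hu), Measure.map_apply (hI.prodMk hY) (hs.prod hu),
    hpre]
  set S := (fun ω => (D.hist t ω, D.X t ω)) ⁻¹' s with hSdef
  set U := D.Ypot t ⁻¹' u with hUdef
  have hS' : MeasurableSet S := hle _ hS
  rw [Measure.restrict_apply (hS'.inter hU), withDensity_apply _ (hS'.inter hU)]
  have hone : ∀ {E : Set Ω}, MeasurableSet E → Integrable (E.indicator fun _ => (1 : ℝ)) μ :=
    fun hE => (integrable_const 1).indicator hE
  have hpm : StronglyMeasurable[D.infoAlg t] (selProb π D t a) :=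
    (measurable_selProb_infoAlg t a).stronglyMeasurable
  have hpull := condExp_stronglyMeasurable_mul_of_bound hle hpm (hone hU) 1
    (ae_of_all μ fun ω => by
      rw [Real.norm_of_nonneg (selProb_nonneg t a ω)]
      exact selProb_le_one t a ω)
  have hint : Integrable (fun ω => selProb π D t a ω * U.indicator (fun _ => (1 : ℝ)) ω) μ :=
    (hone hU).bdd_mul (hD.measurable_selProb t a).aestronglyMeasurable
      (ae_of_all μ fun ω => by
        rw [Real.norm_of_nonneg (selProb_nonneg t a ω)]
        exact selProb_le_one t a ω)
  -- On sets of the information algebra both sides can be conditioned: the conditional probability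
  -- of the intersection factors, its action factor is the selection probability, and this factor is
  -- then pulled back inside. No regular conditional distribution enters.
  have key : ∫ ω in S, (D.A t ⁻¹' {a} ∩ U).indicator (fun _ => (1 : ℝ)) ω ∂μ =
      ∫ ω in S, selProb π D t a ω * U.indicator (fun _ => (1 : ℝ)) ω ∂μ := by
    rw [← setIntegral_condExp hle (hone (hA.inter hU)) hS, ← setIntegral_condExp hle hint hS]
    refine integral_congr_ae (ae_restrict_of_ae ?_)
    filter_upwards [hunc t {a} u (measurableSet_singleton a) hu, hD.action_law t a, hpull]
      with ω h1 h2 h3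
    rw [h1, h2]
    exact h3.symm
  have hL : μ (S ∩ U ∩ D.A t ⁻¹' {a}) =
      ENNReal.ofReal (∫ ω in S, (D.A t ⁻¹' {a} ∩ U).indicator (fun _ => (1 : ℝ)) ω ∂μ) := by
    rw [setIntegral_indicator (hA.inter hU), setIntegral_const, smul_eq_mul, mul_one,
      ofReal_measureReal]
    congr 1
    ext ω
    simp only [Set.mem_inter_iff]
    tauto
  have hR : ∫⁻ ω in S ∩ U, ENNReal.ofReal (selProb π D t a ω) ∂μ =
      ENNReal.ofReal (∫ ω in S, selProb π D t a ω * U.indicator (fun _ => (1 : ℝ)) ω ∂μ) := by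
    have hind : ∀ ω, selProb π D t a ω * U.indicator (fun _ => (1 : ℝ)) ω =
        U.indicator (selProb π D t a) ω := fun ω => by
      by_cases h : ω ∈ U <;> simp [h]
    simp_rw [hind]
    rw [setIntegral_indicator hU, ofReal_integral_eq_lintegral_ofReal]
    · refine (Integrable.of_bound (hD.measurable_selProb t a).aestronglyMeasurable 1
        (ae_of_all μ fun ω => ?_)).integrableOn
      rw [Real.norm_of_nonneg (selProb_nonneg t a ω)]
      exact selProb_le_one t a ω
    · exact ae_of_all _ fun ω => selProb_nonneg t a ω
  rw [Set.inter_assoc] at hL ⊢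
  rw [hL, hR, key]

variable {E : Type*} [NormedAddCommGroup E] [NormedSpace ℝ E]

/-- Values in a general normed space cover both the real correlations of the weak law and the
complex characters of the central limit theorem. -/
lemma setIntegral_action (hD : IsBanditProcess μ P π D) (hunc : Unconfounded μ D) (t : ℕ)
    (a : Fin K) {F : ((Fin t → Obs d K) × Ctx d) × (Fin K → ℝ) → E} (hF : StronglyMeasurable F) :
    ∫ ω in D.A t ⁻¹' {a}, F ((D.hist t ω, D.X t ω), D.Ypot t ω) ∂μ =
      ∫ ω, selProb π D t a ω • F ((D.hist t ω, D.X t ω), D.Ypot t ω) ∂μ := by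
  have hm : Measurable fun ω => ((D.hist t ω, D.X t ω), D.Ypot t ω) :=
    ((hD.measurable_hist t).prodMk (hD.measurable_X t)).prodMk (hD.measurable_Ypot t)
  rw [← integral_map hm.aemeasurable hF.aestronglyMeasurable, map_restrict_action hD hunc t a,
    integral_map hm.aemeasurable hF.aestronglyMeasurable,
    integral_withDensity_eq_integral_toReal_smul]
  · simp_rw [ENNReal.toReal_ofReal (selProb_nonneg t a _)]
  · exact (hD.measurable_selProb t a).ennreal_ofReal
  · exact ae_of_all _ fun _ => ENNReal.ofReal_lt_top

lemma weight_eq (hD : IsBanditProcess μ P π D) (a : Fin K) (t : ℕ) (ω : Ω) :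
    weight D a t ω = (D.A t ⁻¹' {a}).indicator (fun ω => (selProb π D t a ω)⁻¹) ω := by
  by_cases h : D.A t ω = a
  · have h' : ω ∈ D.A t ⁻¹' {a} := h
    rw [Set.indicator_of_mem h', weight, if_pos h, hD.recorded, selProb, h]
  · have h' : ω ∉ D.A t ⁻¹' {a} := h
    rw [Set.indicator_of_notMem h', weight, if_neg h]

/-- Powers of the inverse probability weight integrate like powers of the inverse selection
probability. -/
lemma integral_weight_pow_smul (hD : IsBanditProcess μ P π D) (hunc : Unconfounded μ D)
    {πmin : ℝ} (hpos : 0 < πmin) (hmin : ∀ t a, ∀ᵐ ω ∂μ, πmin ≤ selProb π D t a ω)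
    (k t : ℕ) (a : Fin K) {q : Ctx d × ℝ → ℝ} (hq : Measurable q)
    {ζ : (Fin t → Obs d K) → E} (hζ : StronglyMeasurable ζ) :
    ∫ ω, (weight D a t ω ^ (k + 1) * q (D.X t ω, D.Y t ω)) • ζ (D.hist t ω) ∂μ =
      ∫ ω, ((selProb π D t a ω)⁻¹ ^ k * q (D.X t ω, D.Ypot t ω a)) • ζ (D.hist t ω) ∂μ := by
  have hA : MeasurableSet (D.A t ⁻¹' {a}) := hD.measurable_A t (measurableSet_singleton a)
  set F : ((Fin t → Obs d K) × Ctx d) × (Fin K → ℝ) → E := fun x =>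
    ((π.prob t x.1.1 x.1.2 a)⁻¹ ^ (k + 1) * q (x.1.2, x.2 a)) • ζ x.1.1 with hFdef
  have hF : StronglyMeasurable F := by
    have hp : Measurable fun x : ((Fin t → Obs d K) × Ctx d) × (Fin K → ℝ) =>
        π.prob t x.1.1 x.1.2 a :=
      ((measurable_pi_apply a).comp (π.measurable_prob t)).comp measurable_fst
    refine StronglyMeasurable.smul ?_ (hζ.comp_measurable (by fun_prop))
    exact (((hp.inv).pow_const _).mul (hq.comp (by fun_prop))).stronglyMeasurable
  have h := setIntegral_action hD hunc t a hF
  rw [← integral_indicator hA] at h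
  calc _ = ∫ ω, (D.A t ⁻¹' {a}).indicator
        (fun ω => F ((D.hist t ω, D.X t ω), D.Ypot t ω)) ω ∂μ := by
        refine integral_congr_ae (ae_of_all _ fun ω => ?_)
        simp only [hD.weight_eq]
        by_cases hω : ω ∈ D.A t ⁻¹' {a}
        · have hω' : D.A t ω = a := hω
          simp only [Set.indicator_of_mem hω, hFdef, selProb, BanditData.Y, hω']
        · simp [Set.indicator_of_notMem hω]
    _ = _ := h
    _ = _ := by
        refine integral_congr_ae ?_
        filter_upwards [hmin t a] with ω hω
        have hne : selProb π D t a ω ≠ 0 := (hpos.trans_le hω).ne'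
        have hsel : π.prob t (D.hist t ω) (D.X t ω) a = selProb π D t a ω := rfl
        simp only [hFdef, hsel]
        rw [smul_smul]
        congr 1
        -- The density cancels exactly one of the k + 1 inverse selection probabilities.
        calc selProb π D t a ω * ((selProb π D t a ω)⁻¹ ^ (k + 1) * q (D.X t ω, D.Ypot t ω a))
            = (selProb π D t a ω * (selProb π D t a ω)⁻¹) *
                ((selProb π D t a ω)⁻¹ ^ k * q (D.X t ω, D.Ypot t ω a)) := by
              rw [pow_succ]
              ring
          _ = _ := by rw [mul_inv_cancel₀ hne, one_mul]

lemma prob_le_one (πbar : StationaryPolicy d K) (x : Ctx d) (a : Fin K) : πbar.prob x a ≤ 1 :=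
  (mem_Icc_of_mem_stdSimplex (πbar.mem_simplex x) a).2

lemma abs_selProb_sub_le_one (πbar : StationaryPolicy d K) (t : ℕ) (a : Fin K) (ω : Ω) :
    |selProb π D t a ω - πbar.prob (D.X t ω) a| ≤ 1 := by
  have h1 := selProb_nonneg (π := π) (D := D) t a ω
  have h2 := selProb_le_one (π := π) (D := D) t a ω
  have h3 := (πbar.mem_simplex (D.X t ω)).1 a
  have h4 := prob_le_one πbar (D.X t ω) a
  rw [abs_le]
  constructor <;> linarith

lemma measurable_stationary (πbar : StationaryPolicy d K) (a : Fin K) :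
    Measurable fun x => πbar.prob x a :=
  (measurable_pi_apply a).comp πbar.measurable_prob

/-- The limit policy inherits the minimum sampling probability. -/
lemma le_stationary (hD : IsBanditProcess μ P π D) {πmin : ℝ}
    (hmin : ∀ t a, ∀ᵐ ω ∂μ, πmin ≤ selProb π D t a ω) {πbar : StationaryPolicy d K}
    (hconv : PolicyConverges μ π D πbar) (a : Fin K) : ∀ᵐ z ∂P, πmin ≤ πbar.prob z.1 a := by
  have hmeas : Measurable fun z : Env d K => πbar.prob z.1 a :=
    (measurable_stationary πbar a).comp measurable_fst
  -- All contexts have the same law, so this probability does not depend on t, while it is bounded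
  -- by a deviation probability of the policy that tends to 0.
  have hsmall : ∀ ε > 0, P {z | πbar.prob z.1 a ≤ πmin - ε} = 0 := by
    intro ε hε
    have hS : MeasurableSet {z : Env d K | πbar.prob z.1 a ≤ πmin - ε} :=
      measurableSet_le hmeas measurable_const
    refine le_antisymm (ge_of_tendsto (tendstoInMeasure_iff_norm.1 (hconv a) ε hε)
      (Eventually.of_forall fun t => ?_)) zero_le
    rw [← hD.env_law t, Measure.map_apply (hD.measurable_env t) hS]
    refine measure_mono_ae ?_
    filter_upwards [hmin t a] with ω hω hz
    change πbar.prob (D.X t ω) a ≤ πmin - ε at hz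
    change ε ≤ ‖selProb π D t a ω - πbar.prob (D.X t ω) a - 0‖
    rw [sub_zero]
    exact le_trans (by linarith) (le_abs_self _)
  have hall : ∀ n : ℕ, ∀ᵐ z ∂P, πmin - ((n : ℝ) + 1)⁻¹ < πbar.prob z.1 a := by
    intro n
    rw [ae_iff]
    simpa only [not_lt] using hsmall ((n : ℝ) + 1)⁻¹ (by positivity)
  filter_upwards [ae_all_iff.2 hall] with z hz
  refine le_of_forall_pos_lt_add fun ε hε => ?_
  obtain ⟨n, hn⟩ := exists_nat_one_div_lt hε
  have := hz n
  rw [one_div] at hn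
  linarith

/-- Convergence of the policy, averaged against an integrable function of the environment. -/
lemma tendsto_integral_mul_abs_sub (hD : IsBanditProcess μ P π D) {πbar : StationaryPolicy d K}
    (hconv : PolicyConverges μ π D πbar) (a : Fin K) {f : Env d K → ℝ} (hf : Integrable f P)
    (hfm : Measurable f) :
    Tendsto (fun t => ∫ ω, |f (D.env t ω)| * |selProb π D t a ω - πbar.prob (D.X t ω) a| ∂μ)
      atTop (𝓝 0) := by
  have := hD.isProbabilityMeasure
  have hgap : ∀ t, Measurable fun ω => |selProb π D t a ω - πbar.prob (D.X t ω) a| := fun t =>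
    ((hD.measurable_selProb t a).sub
      ((measurable_stationary πbar a).comp (hD.measurable_X t))).abs
  have hgap_int : ∀ t, Integrable (fun ω => |selProb π D t a ω - πbar.prob (D.X t ω) a|) μ :=
    fun t => Integrable.of_bound (hgap t).aestronglyMeasurable 1 (ae_of_all _ fun ω => by
      rw [Real.norm_eq_abs, abs_abs]
      exact abs_selProb_sub_le_one πbar t a ω)
  -- The gap is bounded by 1, so convergence in measure gives convergence in mean.
  have hgap_lim : Tendsto (fun t => ∫ ω, |selProb π D t a ω - πbar.prob (D.X t ω) a| ∂μ) atTop
      (𝓝 0) := by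
    rw [Metric.tendsto_atTop]
    intro ε hε
    have hc := tendstoInMeasure_iff_measureReal_norm.1 (hconv a) (ε / 2) (by positivity)
    obtain ⟨N, hN⟩ := Metric.tendsto_atTop.1 hc (ε / 2) (by positivity)
    refine ⟨N, fun t ht => ?_⟩
    rw [Real.dist_eq, sub_zero, abs_of_nonneg (integral_nonneg fun ω => abs_nonneg _)]
    have h1 := hN t ht
    rw [Real.dist_eq, sub_zero, abs_of_nonneg measureReal_nonneg] at h1
    set B : Set Ω := {ω | ε / 2 ≤ ‖π.prob t (D.hist t ω) (D.X t ω) a -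
      πbar.prob (D.X t ω) a - 0‖} with hB
    have hBm : MeasurableSet B := by
      have := hgap t
      simp only [hB, sub_zero, Real.norm_eq_abs]
      exact measurableSet_le measurable_const this
    calc ∫ ω, |selProb π D t a ω - πbar.prob (D.X t ω) a| ∂μ
        ≤ ∫ ω, (ε / 2 + B.indicator (fun _ => (1 : ℝ)) ω) ∂μ := by
          refine integral_mono (hgap_int t)
            ((integrable_const _).add ((integrable_const _).indicator hBm)) fun ω => ?_
          by_cases h : ω ∈ B
          · simp only [Set.indicator_of_mem h]
            linarith [abs_selProb_sub_le_one (π := π) (D := D) πbar t a ω]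
          · simp only [Set.indicator_of_notMem h, add_zero]
            simp only [hB, sub_zero, Set.mem_ofPred_eq, not_le] at h
            exact h.le
      _ = ε / 2 + μ.real B := by
          rw [integral_add (integrable_const _) ((integrable_const _).indicator hBm),
            integral_indicator hBm]
          simp
      _ < ε := by linarith
  -- Truncation: |f| ≤ N + (|f| − N)⁺. The excess has a small integral, uniformly in t since the
  -- environments are identically distributed, and the bounded part is controlled by the mean gap.
  have htail : Tendsto (fun N : ℕ => ∫ z, max (|f z| - N) 0 ∂P) atTop (𝓝 0) := by
    have := tendsto_integral_of_dominated_convergence (μ := P)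
      (F := fun (N : ℕ) z => max (|f z| - N) 0) (f := fun _ => 0) (fun z => |f z|)
      (fun N => by fun_prop) hf.abs
      (fun N => ae_of_all _ fun z => by
        rw [Real.norm_of_nonneg (le_max_right _ _)]
        exact max_le (by linarith [N.cast_nonneg (α := ℝ)]) (abs_nonneg _))
      (ae_of_all _ fun z => by
        refine tendsto_const_nhds.congr' ?_
        filter_upwards [eventually_ge_atTop ⌈|f z|⌉₊] with N hN
        rw [max_eq_right]
        linarith [Nat.ceil_le.1 hN])
    simpa using this
  rw [Metric.tendsto_atTop]
  intro ε hε
  obtain ⟨N, hN⟩ := (htail.eventually_lt_const (show 0 < ε / 2 by positivity)).exists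
  have hlim := (hgap_lim.const_mul (N : ℝ)).eventually_lt_const
    (show (N : ℝ) * 0 < ε / 2 by simpa using half_pos hε)
  obtain ⟨t₀, ht₀⟩ := eventually_atTop.1 hlim
  refine ⟨t₀, fun t ht => ?_⟩
  rw [Real.dist_eq, sub_zero,
    abs_of_nonneg (integral_nonneg fun ω => mul_nonneg (abs_nonneg _) (abs_nonneg _))]
  have htm : Measurable fun z : Env d K => max (|f z| - N) 0 := by fun_prop
  have hti : Integrable (fun z : Env d K => max (|f z| - N) 0) P :=
    ((hf.abs.sub (integrable_const _)).sup (integrable_const 0))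
  have hfi := (hD.integrable_env t hf).abs
  calc ∫ ω, |f (D.env t ω)| * |selProb π D t a ω - πbar.prob (D.X t ω) a| ∂μ
      ≤ ∫ ω, (N * |selProb π D t a ω - πbar.prob (D.X t ω) a| +
          max (|f (D.env t ω)| - N) 0) ∂μ := by
        refine integral_mono_of_nonneg
          (ae_of_all _ fun ω => mul_nonneg (abs_nonneg _) (abs_nonneg _))
          (((hgap_int t).const_mul _).add (hD.integrable_env t hti)) (ae_of_all _ fun ω => ?_)
        have h1 := abs_selProb_sub_le_one (π := π) (D := D) πbar t a ω
        have h0 := abs_nonneg (selProb π D t a ω - πbar.prob (D.X t ω) a)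
        have h2 := le_max_left (|f (D.env t ω)| - N) 0
        have h3 := le_max_right (|f (D.env t ω)| - N) 0
        simp only
        nlinarith
    _ = N * ∫ ω, |selProb π D t a ω - πbar.prob (D.X t ω) a| ∂μ +
          ∫ z, max (|f z| - N) 0 ∂P := by
        rw [integral_add ((hgap_int t).const_mul _) (hD.integrable_env t hti), integral_const_mul,
          hD.integral_env t htm]
    _ < ε := by linarith [ht₀ t ht]

end IsBanditProcess

end

/-! ### Decorrelation from the past and the weighted law of large numbers. -/

namespace IsBanditProcess

variable {d K : ℕ} {Ω : Type*} [MeasurableSpace Ω]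
  {μ : Measure Ω} [IsProbabilityMeasure μ] {P : Measure (Env d K)}
  {π : BehaviorPolicy d K} {D : BanditData d K Ω}

/-- The factor k makes the bound 0 for k = 0; this is what later yields conditional means that
vanish exactly rather than asymptotically. -/
lemma abs_inv_pow_sub_le {m x y : ℝ} (hm : 0 < m) (hx : m ≤ x) (hy : m ≤ y) {k : ℕ}
    (hk : k ≤ 1) : |x⁻¹ ^ k - y⁻¹ ^ k| ≤ k * (m⁻¹ ^ 2 * |x - y|) := by
  have hx0 := hm.trans_le hx
  have hy0 := hm.trans_le hy
  interval_cases k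
  · simp
  · have h1 : x⁻¹ - y⁻¹ = (x⁻¹ * y⁻¹) * (y - x) := by field_simp
    have h2 : x⁻¹ * y⁻¹ ≤ m⁻¹ ^ 2 := by
      rw [sq]
      exact mul_le_mul (inv_anti₀ hm hx) (inv_anti₀ hm hy) (by positivity) (by positivity)
    simp only [pow_one, Nat.cast_one, one_mul]
    rw [h1, abs_mul, abs_of_nonneg (by positivity), abs_sub_comm]
    exact mul_le_mul_of_nonneg_right h2 (abs_nonneg _)

lemma abs_weight_le (hD : IsBanditProcess μ P π D) {πmin : ℝ} (hpos : 0 < πmin)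
    (hmin : ∀ t a, ∀ᵐ ω ∂μ, πmin ≤ selProb π D t a ω) (a : Fin K) (t : ℕ) :
    ∀ᵐ ω ∂μ, |weight D a t ω| ≤ πmin⁻¹ := by
  filter_upwards [hmin t a] with ω hω
  rw [hD.weight_eq]
  by_cases h : ω ∈ D.A t ⁻¹' {a}
  · rw [Set.indicator_of_mem h, abs_of_nonneg (inv_nonneg.2 (selProb_nonneg t a ω))]
    exact inv_anti₀ hpos hω
  · rw [Set.indicator_of_notMem h, abs_zero]
    exact inv_nonneg.2 hpos.le

/-- Off the event of selecting `a` both sides vanish, because the exponent is positive. This trades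
the observed outcome for one whose law is known. -/
lemma weight_mul_eq (D : BanditData d K Ω) (a : Fin K) (t k : ℕ) (q : Ctx d × ℝ → ℝ) (ω : Ω) :
    weight D a t ω ^ (k + 1) * q (D.X t ω, D.Y t ω) =
      weight D a t ω ^ (k + 1) * q (D.X t ω, D.Ypot t ω a) := by
  by_cases h : D.A t ω = a
  · simp only [BanditData.Y, h]
  · simp [weight, h]

/-- The weighted functionals inherit the moments of the unweighted ones. -/
lemma integrable_weight_pow_mul (hD : IsBanditProcess μ P π D) {πmin : ℝ} (hpos : 0 < πmin)
    (hmin : ∀ t a, ∀ᵐ ω ∂μ, πmin ≤ selProb π D t a ω) (k t : ℕ) (a : Fin K)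
    {q : Ctx d × ℝ → ℝ} (hqi : Integrable (fun z : Env d K => q (z.1, z.2 a)) P) :
    Integrable (fun ω => weight D a t ω ^ (k + 1) * q (D.X t ω, D.Y t ω)) μ := by
  simp_rw [weight_mul_eq]
  refine (hD.integrable_env t hqi).bdd_mul (c := πmin⁻¹ ^ (k + 1))
    ((hD.measurable_weight a t).pow_const _).aestronglyMeasurable ?_
  filter_upwards [hD.abs_weight_le hpos hmin a t] with ω hω
  rw [norm_pow]
  exact pow_le_pow_left₀ (norm_nonneg _) hω _

lemma integral_weight_pow_mul_le (hD : IsBanditProcess μ P π D) {πmin : ℝ} (hpos : 0 < πmin)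
    (hmin : ∀ t a, ∀ᵐ ω ∂μ, πmin ≤ selProb π D t a ω) (k t : ℕ) (a : Fin K)
    {q : Ctx d × ℝ → ℝ} (hq : Measurable q) (hq0 : ∀ x, 0 ≤ q x)
    (hqi : Integrable (fun z : Env d K => q (z.1, z.2 a)) P) :
    ∫ ω, weight D a t ω ^ (k + 1) * q (D.X t ω, D.Y t ω) ∂μ ≤
      πmin⁻¹ ^ (k + 1) * ∫ z, q (z.1, z.2 a) ∂P := by
  rw [← hD.integral_env t (f := fun z => q (z.1, z.2 a)) (hq.comp (by fun_prop)),
    ← integral_const_mul]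
  refine integral_mono_ae (hD.integrable_weight_pow_mul hpos hmin k t a hqi)
    ((hD.integrable_env t hqi).const_mul _) ?_
  filter_upwards [hD.abs_weight_le hpos hmin a t] with ω hω
  rw [weight_mul_eq]
  refine mul_le_mul_of_nonneg_right ?_ (hq0 _)
  exact (le_abs_self _).trans
    ((abs_pow _ _).le.trans (pow_le_pow_left₀ (abs_nonneg _) hω _))

variable {E : Type*} [NormedAddCommGroup E] [NormedSpace ℝ E]

/-- The weighted functional of a round, centered at its limiting mean, is almost uncorrelated with
functions of the history; for `k = 0` the correlation vanishes. -/
lemma norm_integral_weight_sub_smul_le (hD : IsBanditProcess μ P π D) (hunc : Unconfounded μ D)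
    {πmin : ℝ} (hpos : 0 < πmin) (hmin : ∀ t a, ∀ᵐ ω ∂μ, πmin ≤ selProb π D t a ω)
    {πbar : StationaryPolicy d K} (hconv : PolicyConverges μ π D πbar)
    {k : ℕ} (hk : k ≤ 1) (t : ℕ) (a : Fin K) {q : Ctx d × ℝ → ℝ} (hq : Measurable q)
    (hqi : Integrable (fun z : Env d K => q (z.1, z.2 a)) P)
    {ζ : (Fin t → Obs d K) → E} (hζ : StronglyMeasurable ζ)
    (hζi : Integrable (fun ω => ζ (D.hist t ω)) μ)
    (hprod : Integrable (fun ω =>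
      (weight D a t ω ^ (k + 1) * q (D.X t ω, D.Y t ω)) • ζ (D.hist t ω)) μ) :
    ‖∫ ω, (weight D a t ω ^ (k + 1) * q (D.X t ω, D.Y t ω) -
        ∫ z, (πbar.prob z.1 a)⁻¹ ^ k * q (z.1, z.2 a) ∂P) • ζ (D.hist t ω) ∂μ‖ ≤
      k * (πmin⁻¹ ^ 2 * ∫ ω, ‖ζ (D.hist t ω)‖ * (|q (D.X t ω, D.Ypot t ω a)| *
        |selProb π D t a ω - πbar.prob (D.X t ω) a|) ∂μ) := by
  set g : Env d K → ℝ := fun z => (πbar.prob z.1 a)⁻¹ ^ k * q (z.1, z.2 a) with hg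
  have hqm : Measurable fun z : Env d K => q (z.1, z.2 a) := hq.comp (by fun_prop)
  have hbarm : Measurable fun z : Env d K => πbar.prob z.1 a :=
    (measurable_stationary πbar a).comp measurable_fst
  have hgm : Measurable g := (hbarm.inv.pow_const _).mul hqm
  have hbar := hD.le_stationary hmin hconv a
  have hgi : Integrable g P := by
    refine hqi.bdd_mul (c := πmin⁻¹ ^ k) (hbarm.inv.pow_const _).aestronglyMeasurable ?_
    filter_upwards [hbar] with z hz
    rw [norm_pow, norm_inv, Real.norm_of_nonneg (hpos.le.trans hz)]
    exact pow_le_pow_left₀ (inv_nonneg.2 (hpos.le.trans hz)) (inv_anti₀ hpos hz) _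
  have hind := hD.env_indep_hist t
  have hζm := hζ.comp_measurable (hD.measurable_hist t)
  -- Here ζ need not be bounded: independence of round and history makes the product of two
  -- integrable factors integrable.
  have hindep : ∀ {f : Env d K → ℝ}, Measurable f → Integrable f P →
      Integrable (fun ω => f (D.env t ω) • ζ (D.hist t ω)) μ := by
    intro f hfm hf
    have hn : Integrable (fun ω => f (D.env t ω) * ‖ζ (D.hist t ω)‖) μ :=
      (hind.comp hfm hζ.norm.measurable).integrable_mul (hD.integrable_env t hf) hζi.norm
    refine (integrable_norm_iff ?_).1 (hn.norm.congr (ae_of_all _ fun ω => ?_))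
    · exact ((hfm.comp (hD.measurable_env t)).stronglyMeasurable.smul hζm).aestronglyMeasurable
    · simp [norm_smul]
  -- Independence also lets the constant mean be replaced by the random variable g of the current
  -- round, so that the two integrands can be compared pointwise.
  have hzero : ∫ ω, (∫ z, g z ∂P) • ζ (D.hist t ω) ∂μ =
      ∫ ω, g (D.env t ω) • ζ (D.hist t ω) ∂μ := by
    rw [hind.integral_fun_comp_smul_comp (hD.measurable_env t).aemeasurable
      (hD.measurable_hist t).aemeasurable hgm.aestronglyMeasurable hζ.aestronglyMeasurable,
      hD.integral_env t hgm, integral_smul]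
  have hsel := hD.measurable_selProb t a
  have hinv : Integrable (fun ω => ((selProb π D t a ω)⁻¹ ^ k * q (D.X t ω, D.Ypot t ω a)) •
      ζ (D.hist t ω)) μ := by
    have h := (hindep hqm hqi).bdd_smul (φ := fun ω => (selProb π D t a ω)⁻¹ ^ k)
      (πmin⁻¹ ^ k) (hsel.inv.pow_const k).aestronglyMeasurable
      (by
        filter_upwards [hmin t a] with ω hω
        rw [norm_pow, norm_inv, Real.norm_of_nonneg (hpos.le.trans hω)]
        exact pow_le_pow_left₀ (inv_nonneg.2 (hpos.le.trans hω)) (inv_anti₀ hpos hω) _)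
    refine h.congr (ae_of_all _ fun ω => ?_)
    simp only [Pi.smul_apply', smul_smul]
    rfl
  have hconst : Integrable (fun ω => (∫ z, g z ∂P) • ζ (D.hist t ω)) μ := hζi.smul _
  simp_rw [sub_smul]
  rw [integral_sub hprod hconst, hD.integral_weight_pow_smul hunc hpos hmin k t a hq hζ,
    hzero, ← integral_sub hinv (hindep hgm hgi), ← integral_const_mul, ← integral_const_mul]
  refine norm_integral_le_of_norm_le ?_ ?_
  · have hgapi := ((hindep hqm hqi).norm.mul_bdd (c := 1)
      (g := fun ω => |selProb π D t a ω - πbar.prob (D.X t ω) a|)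
      ((hsel.sub ((measurable_stationary πbar a).comp
        (hD.measurable_X t))).abs.aestronglyMeasurable)
      (ae_of_all _ fun ω => by
        rw [Real.norm_eq_abs, abs_abs]
        exact abs_selProb_sub_le_one πbar t a ω))
    refine ((hgapi.const_mul (πmin⁻¹ ^ 2)).const_mul (k : ℝ)).congr (ae_of_all _ fun ω => ?_)
    simp only [norm_smul, Real.norm_eq_abs, BanditData.env]
    ring
  · filter_upwards [hmin t a, hD.ae_env t hbar] with ω h1 h2
    simp only [hg, BanditData.env]
    rw [← sub_smul, ← sub_mul, norm_smul, norm_mul]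
    have h3 := abs_inv_pow_sub_le hpos h1 h2 hk
    calc _ ≤ (k * (πmin⁻¹ ^ 2 * |selProb π D t a ω - πbar.prob (D.X t ω) a|)) *
          ‖q (D.X t ω, D.Ypot t ω a)‖ * ‖ζ (D.hist t ω)‖ :=
          mul_le_mul_of_nonneg_right (mul_le_mul_of_nonneg_right h3 (norm_nonneg _))
            (norm_nonneg _)
      _ = _ := by
        rw [Real.norm_eq_abs]
        ring

lemma integral_mul_sq_le {f g : Ω → ℝ} (hf : MemLp f 2 μ) (hg : MemLp g 2 μ) (hf0 : 0 ≤ᵐ[μ] f)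
    (hg0 : 0 ≤ᵐ[μ] g) :
    ∫ ω, f ω * g ω ∂μ ≤ √(∫ ω, f ω ^ 2 ∂μ) * √(∫ ω, g ω ^ 2 ∂μ) := by
  have h := integral_mul_le_Lp_mul_Lq_of_nonneg Real.HolderConjugate.two_two hf0 hg0
    (by simpa using hf) (by simpa using hg)
  simpa [Real.sqrt_eq_rpow] using h

/-- Law of large numbers for inverse probability weighted averages. -/
lemma tendstoInMeasure_weighted_average (hD : IsBanditProcess μ P π D) (hunc : Unconfounded μ D)
    {πmin : ℝ} (hpos : 0 < πmin) (hmin : ∀ t a, ∀ᵐ ω ∂μ, πmin ≤ selProb π D t a ω)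
    {πbar : StationaryPolicy d K} (hconv : PolicyConverges μ π D πbar)
    {k : ℕ} (hk : k ≤ 1) (a : Fin K) {q : Ctx d × ℝ → ℝ} (hq : Measurable q)
    (hq2 : MemLp (fun z : Env d K => q (z.1, z.2 a)) 2 P) :
    TendstoInMeasure μ (fun (T : ℕ) ω => (T : ℝ)⁻¹ * ∑ t ∈ Finset.range T,
      weight D a t ω ^ (k + 1) * q (D.X t ω, D.Y t ω)) atTop
      (fun _ => ∫ z, (πbar.prob z.1 a)⁻¹ ^ k * q (z.1, z.2 a) ∂P) := by
  have := hD.isProbabilityMeasure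
  set c : ℝ := ∫ z, (πbar.prob z.1 a)⁻¹ ^ k * q (z.1, z.2 a) ∂P with hc
  set η : ℕ → Ω → ℝ := fun t ω => weight D a t ω ^ (k + 1) * q (D.X t ω, D.Y t ω) - c with hη
  have hqm : Measurable fun z : Env d K => q (z.1, z.2 a) := hq.comp (by fun_prop)
  have hqi : Integrable (fun z : Env d K => q (z.1, z.2 a)) P := hq2.integrable one_le_two
  have hwqm : ∀ t, Measurable fun ω => weight D a t ω ^ (k + 1) * q (D.X t ω, D.Y t ω) :=
    fun t => ((hD.measurable_weight a t).pow_const _).mul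
      (hq.comp ((hD.measurable_X t).prodMk (hD.measurable_Y t)))
  have hsq : ∀ t ω, (weight D a t ω ^ (k + 1) * q (D.X t ω, D.Y t ω)) ^ 2 =
      weight D a t ω ^ ((2 * k + 1) + 1) * (fun x => q x ^ 2) (D.X t ω, D.Y t ω) := by
    intro t ω
    simp only
    ring
  have hwq2 : ∀ t, MemLp (fun ω => weight D a t ω ^ (k + 1) * q (D.X t ω, D.Y t ω)) 2 μ := by
    intro t
    rw [memLp_two_iff_integrable_sq (hwqm t).aestronglyMeasurable]
    simp_rw [hsq]
    exact hD.integrable_weight_pow_mul hpos hmin _ t a (q := fun x => q x ^ 2) hq2.integrable_sq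
  have hη2 : ∀ t, MemLp (η t) 2 μ := fun t => (hwq2 t).sub (memLp_const c)
  set C : ℝ := 2 * (πmin⁻¹ ^ ((2 * k + 1) + 1) * ∫ z, q (z.1, z.2 a) ^ 2 ∂P) + 2 * c ^ 2 with hC
  have hCbound : ∀ t, ∫ ω, η t ω ^ 2 ∂μ ≤ C := by
    intro t
    have h1 := hD.integral_weight_pow_mul_le hpos hmin (2 * k + 1) t a (q := fun x => q x ^ 2)
      (hq.pow_const 2) (fun x => sq_nonneg _) hq2.integrable_sq
    simp_rw [← hsq] at h1
    calc ∫ ω, η t ω ^ 2 ∂μ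
        ≤ ∫ ω, (2 * (weight D a t ω ^ (k + 1) * q (D.X t ω, D.Y t ω)) ^ 2 + 2 * c ^ 2) ∂μ := by
          refine integral_mono (hη2 t).integrable_sq
            (((hwq2 t).integrable_sq.const_mul 2).add (integrable_const _)) fun ω => ?_
          simp only [hη]
          nlinarith [sq_nonneg (weight D a t ω ^ (k + 1) * q (D.X t ω, D.Y t ω) + c)]
      _ ≤ C := by
          rw [integral_add ((hwq2 t).integrable_sq.const_mul 2) (integrable_const _),
            integral_const_mul]
          simp only [integral_const, probReal_univ, one_smul]
          linarith
  have hlim := hD.tendsto_integral_mul_abs_sub hconv a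
    (f := fun z => q (z.1, z.2 a) ^ 2) hq2.integrable_sq (hqm.pow_const 2)
  -- By Cauchy–Schwarz the correlation with an earlier summand, whose second moment is at most C, is
  -- controlled by the mean of q² times the policy gap, uniformly in s.
  set ε : ℕ → ℝ := fun t => k * (πmin⁻¹ ^ 2 * (√C * √(∫ ω, |q ((D.env t ω).1, (D.env t ω).2 a) ^ 2| *
    |selProb π D t a ω - πbar.prob (D.X t ω) a| ∂μ))) with hεdef
  have hε : Tendsto ε atTop (𝓝 0) := by
    have := (((hlim.sqrt).const_mul (√C)).const_mul (πmin⁻¹ ^ 2)).const_mul (k : ℝ)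
    simpa [hεdef] using this
  have havg := tendstoInMeasure_average hη2 hCbound hε fun s t hst => ?_
  · have h := tendstoInMeasure_comp_continuousAt (g := fun x => x + c) havg (by fun_prop)
    simp only [zero_add] at h
    refine h.congr' ?_ EventuallyEq.rfl
    filter_upwards [eventually_gt_atTop 0] with T hT
    refine ae_of_all _ fun ω => ?_
    have hT' : (T : ℝ) ≠ 0 := by exact_mod_cast hT.ne'
    simp only [hη, Finset.sum_sub_distrib, Finset.sum_const, Finset.card_range, nsmul_eq_mul]
    field_simp
    ring
  -- For s < t the summand `η s` is a function of the history, since selection probability, action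
  -- and outcome are all recorded.
  · set ζ : (Fin t → Obs d K) → ℝ := fun h => obsWeight a (h ⟨s, hst⟩) ^ (k + 1) *
      q ((h ⟨s, hst⟩).1, (h ⟨s, hst⟩).2.2.2) - c with hζ
    have hζη : ∀ ω, ζ (D.hist t ω) = η s ω := fun ω => rfl
    have hζm : StronglyMeasurable ζ := by
      refine Measurable.stronglyMeasurable (Measurable.sub_const (Measurable.mul ?_ ?_) _)
      · exact ((measurable_obsWeight a).comp (measurable_pi_apply (⟨s, hst⟩ : Fin t))).pow_const _
      · exact hq.comp (by fun_prop)
    have hgap : Measurable fun ω => |selProb π D t a ω - πbar.prob (D.X t ω) a| :=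
      ((hD.measurable_selProb t a).sub
        ((measurable_stationary πbar a).comp (hD.measurable_X t))).abs
    have h := hD.norm_integral_weight_sub_smul_le hunc hpos hmin hconv hk t a hq hqi hζm
      (by simp_rw [hζη]; exact (hη2 s).integrable one_le_two)
      (by simp_rw [hζη, smul_eq_mul]; exact (hwq2 t).integrable_mul (hη2 s))
    simp_rw [hζη, smul_eq_mul] at h
    calc |∫ ω, η s ω * η t ω ∂μ| = ‖∫ ω, η t ω * η s ω ∂μ‖ := by
          simp_rw [mul_comm (η s _)]
          rfl
      _ ≤ _ := h
      _ ≤ ε t := by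
        refine mul_le_mul_of_nonneg_left (mul_le_mul_of_nonneg_left ?_ (by positivity))
          k.cast_nonneg
        have hqt : MemLp (fun ω => |q (D.X t ω, D.Ypot t ω a)|) 2 μ := by
          have hm : Measurable fun ω => q (D.X t ω, D.Ypot t ω a) :=
            hqm.comp (hD.measurable_env t)
          refine MemLp.abs ?_
          rw [memLp_two_iff_integrable_sq hm.aestronglyMeasurable]
          exact hD.integrable_env t hq2.integrable_sq
        have hqg : MemLp (fun ω => |q (D.X t ω, D.Ypot t ω a)| *
            |selProb π D t a ω - πbar.prob (D.X t ω) a|) 2 μ := by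
          refine hqt.mono (hqt.1.mul hgap.aestronglyMeasurable) (ae_of_all _ fun ω => ?_)
          rw [norm_mul]
          refine mul_le_of_le_one_right (norm_nonneg _) ?_
          rw [Real.norm_eq_abs, abs_abs]
          exact abs_selProb_sub_le_one πbar t a ω
        refine (integral_mul_sq_le (hη2 s).norm hqg (ae_of_all _ fun ω => norm_nonneg _)
          (ae_of_all _ fun ω => mul_nonneg (abs_nonneg _) (abs_nonneg _))).trans ?_
        refine mul_le_mul (Real.sqrt_le_sqrt ?_) (Real.sqrt_le_sqrt ?_) (Real.sqrt_nonneg _)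
          (Real.sqrt_nonneg _)
        · simpa using hCbound s
        · refine integral_mono hqg.integrable_sq ?_ fun ω => ?_
          · have hi := (hD.integrable_env t hq2.integrable_sq).abs
            refine hi.mul_bdd (c := 1) hgap.aestronglyMeasurable (ae_of_all _ fun ω => ?_)
            rw [Real.norm_eq_abs, abs_abs]
            exact abs_selProb_sub_le_one πbar t a ω
          · simp only [BanditData.env]
            rw [mul_pow, sq_abs, abs_of_nonneg (sq_nonneg (q _))]
            refine mul_le_mul_of_nonneg_left ?_ (sq_nonneg _)
            -- The gap is at most 1, so its square is at most the gap itself.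
            exact pow_le_of_le_one (abs_nonneg _) (abs_selProb_sub_le_one πbar t a ω) two_ne_zero

end IsBanditProcess

/-! ### Central limit theorem for weighted sums over all arms. -/

namespace IsBanditProcess

variable {d K : ℕ} {Ω : Type*} [MeasurableSpace Ω]
  {μ : Measure Ω} [IsProbabilityMeasure μ] {P : Measure (Env d K)}
  {π : BehaviorPolicy d K} {D : BanditData d K Ω}

/-- At each round only the selected arm has a nonzero weight. -/
lemma sum_weight_mul_pow (D : BanditData d K Ω) (t n : ℕ) (ω : Ω) (f : Fin K → ℝ) :
    (∑ a, weight D a t ω * f a) ^ (n + 1) = ∑ a, weight D a t ω ^ (n + 1) * f a ^ (n + 1) := by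
  have h : ∀ (m : ℕ) (g : Fin K → ℝ), ∑ a, weight D a t ω ^ (m + 1) * g a =
      (D.p t ω)⁻¹ ^ (m + 1) * g (D.A t ω) := by
    intro m g
    rw [Finset.sum_eq_single (D.A t ω)]
    · simp [weight]
    · intro b _ hb
      simp [weight, hb.symm]
    · simp
  rw [h n fun a => f a ^ (n + 1), ← mul_pow]
  congr 1
  simpa using h 0 f

lemma integrable_of_pow_four {f : Ω → ℝ} (hf : AEStronglyMeasurable f μ)
    (h4 : Integrable (fun ω => f ω ^ 4) μ) {n : ℕ} (hn : n ≤ 4) :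
    Integrable (fun ω => |f ω| ^ n) μ := by
  refine ((integrable_const (1 : ℝ)).add h4).mono'
    ((continuous_abs.pow n).comp_aestronglyMeasurable hf) (ae_of_all _ fun ω => ?_)
  rw [norm_pow, Real.norm_eq_abs, abs_abs, Pi.add_apply]
  have h0 : f ω ^ 4 = |f ω| ^ 4 := by rw [← abs_pow, abs_of_nonneg (by positivity)]
  rw [h0]
  rcases le_total |f ω| 1 with h | h
  · linarith [pow_le_one₀ (n := n) (abs_nonneg (f ω)) h, pow_nonneg (abs_nonneg (f ω)) 4]
  · linarith [pow_le_pow_right₀ h hn]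

/-- Central limit theorem for inverse probability weighted sums with centered summands, in terms
of characteristic functions. -/
lemma tendsto_integral_cexp_weighted_sum (hD : IsBanditProcess μ P π D) (hunc : Unconfounded μ D)
    {πmin : ℝ} (hpos : 0 < πmin) (hmin : ∀ t a, ∀ᵐ ω ∂μ, πmin ≤ selProb π D t a ω)
    {πbar : StationaryPolicy d K} (hconv : PolicyConverges μ π D πbar)
    {q : Fin K → Ctx d × ℝ → ℝ} (hq : ∀ a, Measurable (q a))
    (hq4 : ∀ a, Integrable (fun z : Env d K => q a (z.1, z.2 a) ^ 4) P)
    (hq0 : ∀ a, ∫ z, q a (z.1, z.2 a) ∂P = 0) :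
    Tendsto (fun T : ℕ => ∫ ω, Complex.exp (((√(T : ℝ))⁻¹ * ∑ t ∈ Finset.range T,
      ∑ a, weight D a t ω * q a (D.X t ω, D.Y t ω) : ℝ) * Complex.I) ∂μ) atTop
      (𝓝 (Real.exp (-((∑ a, ∫ z, (πbar.prob z.1 a)⁻¹ * q a (z.1, z.2 a) ^ 2 ∂P) / 2)) : ℂ)) := by
  have := hD.isProbabilityMeasure
  set ξ : ℕ → Ω → ℝ := fun t ω => ∑ a, weight D a t ω * q a (D.X t ω, D.Y t ω) with hξ
  have hqm : ∀ a, Measurable fun z : Env d K => q a (z.1, z.2 a) :=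
    fun a => (hq a).comp (by fun_prop)
  have hq2 : ∀ a, Integrable (fun z : Env d K => q a (z.1, z.2 a) ^ 2) P := fun a => by
    simpa using integrable_of_pow_four (hqm a).aestronglyMeasurable (hq4 a)
      (show 2 ≤ 4 by norm_num)
  have hq1 : ∀ a, Integrable (fun z : Env d K => q a (z.1, z.2 a)) P := fun a => by
    rw [← integrable_norm_iff (hqm a).aestronglyMeasurable]
    simpa using integrable_of_pow_four (hqm a).aestronglyMeasurable (hq4 a)
      (show 1 ≤ 4 by norm_num)
  have hw : ∀ t a, Measurable fun ω => weight D a t ω * q a (D.X t ω, D.Y t ω) := fun t a =>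
    (hD.measurable_weight a t).mul ((hq a).comp ((hD.measurable_X t).prodMk (hD.measurable_Y t)))
  have hξm : ∀ t, Measurable (ξ t) := fun t => Finset.measurable_sum _ fun a _ => hw t a
  -- There are no cross terms between arms; this is where block diagonality comes from.
  have hξ2 : ∀ t ω, ξ t ω ^ 2 =
      ∑ a, weight D a t ω ^ (1 + 1) * (fun x => q a x ^ 2) (D.X t ω, D.Y t ω) :=
    fun t ω => sum_weight_mul_pow D t 1 ω _
  have hξ4 : ∀ t ω, ξ t ω ^ 4 =
      ∑ a, weight D a t ω ^ (3 + 1) * (fun x => q a x ^ 4) (D.X t ω, D.Y t ω) :=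
    fun t ω => sum_weight_mul_pow D t 3 ω _
  have hi2 : ∀ t a, Integrable (fun ω =>
      weight D a t ω ^ (1 + 1) * (fun x => q a x ^ 2) (D.X t ω, D.Y t ω)) μ := fun t a =>
    hD.integrable_weight_pow_mul hpos hmin 1 t a (q := fun x => q a x ^ 2) (hq2 a)
  have hi1 : ∀ t a, Integrable (fun ω =>
      weight D a t ω ^ (0 + 1) * q a (D.X t ω, D.Y t ω)) μ := fun t a =>
    hD.integrable_weight_pow_mul hpos hmin 0 t a (hq1 a)
  have hi4 : ∀ t a, Integrable (fun ω =>
      weight D a t ω ^ (3 + 1) * (fun x => q a x ^ 4) (D.X t ω, D.Y t ω)) μ := fun t a =>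
    hD.integrable_weight_pow_mul hpos hmin 3 t a (q := fun x => q a x ^ 4) (hq4 a)
  have hξ4i : ∀ t, Integrable (fun ω => ξ t ω ^ 4) μ := fun t => by
    simp_rw [hξ4]
    exact integrable_finsetSum _ fun a _ => hi4 t a
  have hξ2i : ∀ t, Integrable (fun ω => ξ t ω ^ 2) μ := fun t => by
    simp_rw [hξ2]
    exact integrable_finsetSum _ fun a _ => hi2 t a
  have hξ1i : ∀ t, Integrable (ξ t) μ := fun t =>
    integrable_finsetSum _ fun a _ => by simpa using hi1 t a
  have hξ3i : ∀ t, Integrable (fun ω => |ξ t ω| ^ 3) μ := fun t =>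
    integrable_of_pow_four (hξm t).aestronglyMeasurable (hξ4i t) (by norm_num)
  -- Third moments are bounded through |ξ|³ ≤ 1 + ξ⁴, uniformly in the round.
  set C : ℝ := 1 + ∑ a, πmin⁻¹ ^ (3 + 1) * ∫ z, q a (z.1, z.2 a) ^ 4 ∂P with hCdef
  have hC : ∀ t, ∫ ω, |ξ t ω| ^ 3 ∂μ ≤ C := by
    intro t
    calc ∫ ω, |ξ t ω| ^ 3 ∂μ ≤ ∫ ω, (1 + ξ t ω ^ 4) ∂μ := by
          refine integral_mono (hξ3i t) ((integrable_const _).add (hξ4i t)) fun ω => ?_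
          have h0 : ξ t ω ^ 4 = |ξ t ω| ^ 4 := by rw [← abs_pow, abs_of_nonneg (by positivity)]
          simp only [h0]
          rcases le_total |ξ t ω| 1 with h | h
          · linarith [pow_le_one₀ (n := 3) (abs_nonneg (ξ t ω)) h,
              pow_nonneg (abs_nonneg (ξ t ω)) 4]
          · linarith [pow_le_pow_right₀ h (show 3 ≤ 4 by norm_num)]
      _ = 1 + ∑ a, ∫ ω, weight D a t ω ^ (3 + 1) *
            (fun x => q a x ^ 4) (D.X t ω, D.Y t ω) ∂μ := by
          rw [integral_add (integrable_const _) (hξ4i t)]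
          simp_rw [hξ4]
          rw [integral_finsetSum _ fun a _ => hi4 t a]
          simp
      _ ≤ C := by
          refine add_le_add le_rfl (Finset.sum_le_sum fun a _ => ?_)
          exact hD.integral_weight_pow_mul_le hpos hmin 3 t a (q := fun x => q a x ^ 4)
            ((hq a).pow_const 4) (fun x => by positivity) (hq4 a)
  set gap : ℕ → Fin K → ℝ := fun t a => ∫ ω, |q a ((D.env t ω).1, (D.env t ω).2 a) ^ 2| *
    |selProb π D t a ω - πbar.prob (D.X t ω) a| ∂μ with hgap
  have hgap_lim : ∀ a, Tendsto (fun t => gap t a) atTop (𝓝 0) := fun a =>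
    hD.tendsto_integral_mul_abs_sub hconv a (f := fun z => q a (z.1, z.2 a) ^ 2) (hq2 a)
      ((hqm a).pow_const 2)
  have hε : Tendsto (fun t => ∑ a, πmin⁻¹ ^ 2 * gap t a) atTop (𝓝 0) := by
    have h := tendsto_finsetSum (Finset.univ : Finset (Fin K))
      fun a (_ : a ∈ Finset.univ) => (hgap_lim a).const_mul (πmin⁻¹ ^ 2)
    simp only [mul_zero, Finset.sum_const_zero] at h
    exact h
  -- Characters of the partial sums, written as bounded functions of the recorded history.
  set ζ : (t : ℕ) → ℝ → (Fin t → Obs d K) → ℂ := fun t c h =>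
    Complex.exp ((c * ∑ s : Fin t, ∑ a, obsWeight a (h s) * q a ((h s).1, (h s).2.2.2) : ℝ) *
      Complex.I) with hζ
  have hζξ : ∀ t c ω, ζ t c (D.hist t ω) =
      Complex.exp ((c * ∑ s ∈ Finset.range t, ξ s ω : ℝ) * Complex.I) := by
    intro t c ω
    rw [Finset.sum_range]
    rfl
  have hζn : ∀ t c h, ‖ζ t c h‖ = 1 := fun t c h => Complex.norm_exp_ofReal_mul_I _
  have hζm : ∀ t c, StronglyMeasurable (ζ t c) := by
    intro t c
    have hsum : Measurable fun h : Fin t → Obs d K =>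
        ∑ s : Fin t, ∑ a, obsWeight a (h s) * q a ((h s).1, (h s).2.2.2) :=
      Finset.measurable_sum _ fun s _ => Finset.measurable_sum _ fun a _ =>
        ((measurable_obsWeight a).comp (measurable_pi_apply s)).mul
          ((hq a).comp (by fun_prop))
    exact (by fun_prop : Measurable (ζ t c)).stronglyMeasurable
  have hζc : ∀ t c, AEStronglyMeasurable (fun ω => ζ t c (D.hist t ω)) μ := fun t c =>
    ((hζm t c).comp_measurable (hD.measurable_hist t)).aestronglyMeasurable
  have hζi : ∀ t c, Integrable (fun ω => ζ t c (D.hist t ω)) μ := fun t c =>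
    Integrable.of_bound (hζc t c) 1 (ae_of_all _ fun ω => (hζn t c _).le)
  have hprod : ∀ t c {f : Ω → ℝ}, Integrable f μ →
      Integrable (fun ω => f ω • ζ t c (D.hist t ω)) μ := fun t c f hf =>
    hf.smul_bdd (C := 1) (hζc t c) (ae_of_all _ fun ω => (hζn t c _).le)
  have hprod_sub : ∀ t c {f : Ω → ℝ}, Integrable f μ → ∀ r : ℝ,
      Integrable (fun ω => (f ω - r) • ζ t c (D.hist t ω)) μ := fun t c f hf r =>
    hprod t c (hf.sub (integrable_const r))
  have hσ : 0 ≤ ∑ a, ∫ z, (πbar.prob z.1 a)⁻¹ * q a (z.1, z.2 a) ^ 2 ∂P :=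
    Finset.sum_nonneg fun a _ => integral_nonneg fun z =>
      mul_nonneg (inv_nonneg.2 ((πbar.mem_simplex z.1).1 a)) (sq_nonneg _)
  refine tendsto_integral_cexp_inv_sqrt_mul_sum (fun t => (hξm t).aemeasurable) hξ3i hξ2i hξ1i hC
    hσ hε (fun t c => ?_) fun t c => ?_
  -- The subtracted means are zero by `hq0`; they are inserted to reach the decorrelation estimate
  -- with k = 0, whose right-hand side is 0.
  · have hsplit : ∀ ω, Complex.exp ((c * ∑ s ∈ Finset.range t, ξ s ω : ℝ) * Complex.I) * ξ t ω =
        ∑ a, (weight D a t ω ^ (0 + 1) * q a (D.X t ω, D.Y t ω) -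
          ∫ z, (πbar.prob z.1 a)⁻¹ ^ 0 * q a (z.1, z.2 a) ∂P) • ζ t c (D.hist t ω) := by
      intro ω
      rw [← hζξ, ← Finset.sum_smul, Complex.real_smul, mul_comm]
      simp [hξ, hq0]
    rw [integral_congr_ae (ae_of_all _ hsplit),
      integral_finsetSum _ fun a _ => hprod_sub t c (hi1 t a) _]
    refine Finset.sum_eq_zero fun a _ => norm_le_zero_iff.1 ?_
    refine (hD.norm_integral_weight_sub_smul_le hunc hpos hmin hconv zero_le_one t a (hq a)
      (hq1 a) (hζm t c) (hζi t c) (hprod t c (hi1 t a))).trans ?_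
    simp
  -- Here k = 1: the squared weight leaves one inverse selection probability, with limit 1/π̄, and
  -- the error is the policy gap weighted by q².
  · have hsplit : ∀ ω, Complex.exp ((c * ∑ s ∈ Finset.range t, ξ s ω : ℝ) * Complex.I) *
        ((ξ t ω ^ 2 - ∑ a, ∫ z, (πbar.prob z.1 a)⁻¹ * q a (z.1, z.2 a) ^ 2 ∂P : ℝ) : ℂ) =
        ∑ a, (weight D a t ω ^ (1 + 1) * (fun x => q a x ^ 2) (D.X t ω, D.Y t ω) -
          ∫ z, (πbar.prob z.1 a)⁻¹ ^ 1 * (fun x => q a x ^ 2) (z.1, z.2 a) ∂P) •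
            ζ t c (D.hist t ω) := by
      intro ω
      rw [← hζξ, ← Finset.sum_smul, Complex.real_smul, mul_comm, hξ2, Finset.sum_sub_distrib]
      simp only [pow_one]
    rw [integral_congr_ae (ae_of_all _ hsplit),
      integral_finsetSum _ fun a _ => hprod_sub t c (hi2 t a) _]
    refine (norm_sum_le _ _).trans (Finset.sum_le_sum fun a _ => ?_)
    refine (hD.norm_integral_weight_sub_smul_le hunc hpos hmin hconv le_rfl t a
      (q := fun x => q a x ^ 2) ((hq a).pow_const 2)
      (hq2 a) (hζm t c) (hζi t c) (hprod t c (hi2 t a))).trans (le_of_eq ?_)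
    simp only [hζn, one_mul, Nat.cast_one]
    rfl

end IsBanditProcess

/-! ### Matrix inverses, moments of the projection model and the Gram matrix. -/

section

variable {d K : ℕ} {Ω : Type*} [MeasurableSpace Ω]

section MatrixInverse

/-- With 0⁻¹ = 0 Cramer's formula also covers singular matrices, so it gives measurability
everywhere and continuity at invertible matrices. -/
lemma inv_entry_eq {d : ℕ} (A : Fin d → Fin d → ℝ) (i j : Fin d) :
    ((Matrix.of A)⁻¹) i j = (Matrix.of A).det⁻¹ * (Matrix.of A).adjugate i j := by
  rw [Matrix.inv_def, Matrix.smul_apply, Ring.inverse_eq_inv', smul_eq_mul]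

lemma continuous_det_of {d : ℕ} :
    Continuous fun A : Fin d → Fin d → ℝ => (Matrix.of A).det :=
  Continuous.matrix_det (A := fun A : Fin d → Fin d → ℝ => Matrix.of A) continuous_id

lemma continuous_adjugate_entry {d : ℕ} (i j : Fin d) :
    Continuous fun A : Fin d → Fin d → ℝ => (Matrix.of A).adjugate i j :=
  (Continuous.matrix_adjugate (A := fun A : Fin d → Fin d → ℝ => Matrix.of A)
    continuous_id).matrix_elem i j

lemma continuousAt_inv_entry {d : ℕ} {A : Fin d → Fin d → ℝ} (hA : IsUnit (Matrix.of A))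
    (i j : Fin d) :
    ContinuousAt (fun A : Fin d → Fin d → ℝ => ((Matrix.of A)⁻¹) i j) A := by
  simp_rw [inv_entry_eq]
  refine ContinuousAt.mul (continuous_det_of.continuousAt.inv₀ ?_)
    (continuous_adjugate_entry i j).continuousAt
  exact ((Matrix.isUnit_iff_isUnit_det _).1 hA).ne_zero

lemma measurable_inv_entry {d : ℕ} (i j : Fin d) :
    Measurable fun A : Fin d → Fin d → ℝ => ((Matrix.of A)⁻¹) i j := by
  simp_rw [inv_entry_eq]
  exact continuous_det_of.measurable.inv.mul (continuous_adjugate_entry i j).measurable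

end MatrixInverse

/-- The standing assumptions: a bandit process with unconfoundedness, converging behavior policy
and minimum sampling probability `πmin`, bounded contexts with invertible second moment matrix,
fourth moments of the potential outcomes, and best linear projection parameters `θ`. -/
structure ProjectionModel (μ : Measure Ω) (P : Measure (Env d K)) (π : BehaviorPolicy d K)
    (D : BanditData d K Ω) (πbar : StationaryPolicy d K) (θ : Fin K → Ctx d) (πmin M : ℝ) :
    Prop where
  process : IsBanditProcess μ P π D
  unconfounded : Unconfounded μ D
  target : IsTarget P θ
  pos : 0 < πmin
  le_selProb : ∀ t a, ∀ᵐ ω ∂μ, πmin ≤ selProb π D t a ω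
  converges : PolicyConverges μ π D πbar
  bounded : ∀ᵐ z ∂P, ‖z.1‖ ≤ M
  isUnit_sigmaX : IsUnit (sigmaX P)
  moment : ∀ a, Integrable (fun z : Env d K => z.2 a ^ 4) P

namespace ProjectionModel

variable {μ : Measure Ω} [IsProbabilityMeasure μ] {P : Measure (Env d K)}
  {π : BehaviorPolicy d K} {D : BanditData d K Ω} {πbar : StationaryPolicy d K}
  {θ : Fin K → Ctx d} {πmin M : ℝ}

/-- The context almost surely lies in a closed ball, which is compact. -/
lemma exists_bound (h : ProjectionModel μ P π D πbar θ πmin M) {b : Ctx d → ℝ}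
    (hb : Continuous b) : ∃ B : ℝ, ∀ᵐ z ∂P, |b z.1| ≤ B := by
  obtain ⟨B, hB⟩ := (isCompact_closedBall (0 : Ctx d) M).exists_bound_of_continuousOn
    hb.continuousOn
  refine ⟨B, ?_⟩
  filter_upwards [h.bounded] with z hz
  exact hB z.1 (by simpa using hz)

lemma integrable_residual_pow (h : ProjectionModel μ P π D πbar θ πmin M) (a : Fin K) {n : ℕ}
    (hn : n ≤ 4) {b : Ctx d → ℝ} (hb : Continuous b) :
    Integrable (fun z : Env d K => (z.2 a - inner ℝ z.1 (θ a)) ^ n * b z.1) P := by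
  have := h.process.isProbabilityMeasure
  have hem : Measurable fun z : Env d K => z.2 a - inner ℝ z.1 (θ a) := by fun_prop
  obtain ⟨B, hB⟩ := h.exists_bound hb
  obtain ⟨S, hS⟩ := h.exists_bound (b := fun x => inner ℝ x (θ a)) (by fun_prop)
  have h4 : Integrable (fun z : Env d K => (z.2 a - inner ℝ z.1 (θ a)) ^ 4) P := by
    -- The constant 8 comes from (y − s)⁴ ≤ 8(y⁴ + s⁴), with s = xᵀθ bounded by S.
    refine (((h.moment a).add (integrable_const (S ^ 4))).const_mul 8).mono'
      (hem.pow_const 4).aestronglyMeasurable ?_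
    filter_upwards [hS] with z hz
    set s : ℝ := inner ℝ z.1 (θ a)
    have hs4 : s ^ 4 ≤ S ^ 4 := by
      have : s ^ 4 = |s| ^ 4 := by rw [← abs_pow, abs_of_nonneg (by positivity)]
      rw [this]
      exact pow_le_pow_left₀ (abs_nonneg _) hz 4
    rw [Real.norm_of_nonneg (by positivity), Pi.add_apply]
    have h1 : (z.2 a - s) ^ 2 ≤ 2 * (z.2 a ^ 2 + s ^ 2) := by nlinarith [sq_nonneg (z.2 a + s)]
    have h2 : ((z.2 a - s) ^ 2) ^ 2 ≤ (2 * (z.2 a ^ 2 + s ^ 2)) ^ 2 :=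
      pow_le_pow_left₀ (sq_nonneg _) h1 2
    nlinarith [sq_nonneg (z.2 a ^ 2 - s ^ 2)]
  have hn' := IsBanditProcess.integrable_of_pow_four hem.aestronglyMeasurable h4 hn
  have hn'' : Integrable (fun z : Env d K => (z.2 a - inner ℝ z.1 (θ a)) ^ n) P := by
    rw [← integrable_norm_iff (hem.pow_const n).aestronglyMeasurable]
    simpa using hn'
  exact hn''.mul_bdd (c := B) (hb.measurable.comp measurable_fst).aestronglyMeasurable hB

lemma memLp_residual_pow (h : ProjectionModel μ P π D πbar θ πmin M) (a : Fin K) {n : ℕ}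
    (hn : n ≤ 2) {b : Ctx d → ℝ} (hb : Continuous b) :
    MemLp (fun z : Env d K => (z.2 a - inner ℝ z.1 (θ a)) ^ n * b z.1) 2 P := by
  have hbm : Measurable fun z : Env d K => b z.1 := hb.measurable.comp measurable_fst
  have hm : Measurable fun z : Env d K => (z.2 a - inner ℝ z.1 (θ a)) ^ n * b z.1 :=
    Measurable.mul (by fun_prop) hbm
  rw [memLp_two_iff_integrable_sq hm.aestronglyMeasurable]
  refine (h.integrable_residual_pow a (n := n * 2) (by omega) (hb.pow 2)).congr
    (ae_of_all _ fun z => ?_)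
  simp only [Pi.pow_apply]
  ring

lemma integrable_inv_mul (h : ProjectionModel μ P π D πbar θ πmin M) (a : Fin K)
    {f : Env d K → ℝ} (hf : Integrable f P) :
    Integrable (fun z => (πbar.prob z.1 a)⁻¹ * f z) P := by
  refine hf.bdd_mul (c := πmin⁻¹)
    ((IsBanditProcess.measurable_stationary πbar a).comp measurable_fst).inv.aestronglyMeasurable ?_
  filter_upwards [h.process.le_stationary h.le_selProb h.converges a] with z hz
  rw [norm_inv, Real.norm_of_nonneg (h.pos.le.trans hz)]
  exact inv_anti₀ h.pos hz

lemma meatEntry_eq (a : Fin K) (i j : Fin d) (z : Env d K) :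
    meatEntry πbar a (θ a) i j z =
      (πbar.prob z.1 a)⁻¹ * ((z.2 a - inner ℝ z.1 (θ a)) ^ 2 * (z.1 i * z.1 j)) := by
  rw [meatEntry, div_eq_mul_inv]
  ring

lemma integrable_meatEntry (h : ProjectionModel μ P π D πbar θ πmin M) (a : Fin K)
    (i j : Fin d) : Integrable (meatEntry πbar a (θ a) i j) P := by
  have := h.integrable_inv_mul a (h.integrable_residual_pow a (n := 2) (by norm_num)
    (b := fun x => x i * x j) (by fun_prop))
  exact this.congr (ae_of_all _ fun z => (meatEntry_eq a i j z).symm)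

/-- The middle matrix of the sandwich. -/
def meat (P : Measure (Env d K)) (πbar : StationaryPolicy d K) (a : Fin K) (θ : Ctx d) :
    Matrix (Fin d) (Fin d) ℝ :=
  Matrix.of fun i j => ∫ z, meatEntry πbar a θ i j z ∂P

lemma inner_eq_sum (x y : Ctx d) : inner ℝ x y = ∑ k, x k * y k := by
  rw [PiLp.inner_apply]
  exact Finset.sum_congr rfl fun k _ => by simp [mul_comm]

/-- This form serves twice: it is visibly nonnegative, and it is the variance that the central limit
theorem produces in direction v. -/
lemma dotProduct_meat_mulVec (h : ProjectionModel μ P π D πbar θ πmin M) (a : Fin K)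
    (v : Fin d → ℝ) :
    v ⬝ᵥ (meat P πbar a (θ a) *ᵥ v) = ∫ z, (πbar.prob z.1 a)⁻¹ *
      ((z.2 a - inner ℝ z.1 (θ a)) * ∑ i, z.1 i * v i) ^ 2 ∂P := by
  have hpt : ∀ z : Env d K, (πbar.prob z.1 a)⁻¹ *
      ((z.2 a - inner ℝ z.1 (θ a)) * ∑ i, z.1 i * v i) ^ 2 =
      ∑ i, ∑ j, v i * v j * meatEntry πbar a (θ a) i j z := by
    intro z
    simp_rw [meatEntry_eq]
    rw [mul_pow, sq (∑ i, z.1 i * v i), Finset.sum_mul_sum, Finset.mul_sum, Finset.mul_sum]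
    refine Finset.sum_congr rfl fun i _ => ?_
    rw [Finset.mul_sum, Finset.mul_sum]
    exact Finset.sum_congr rfl fun j _ => by ring
  simp_rw [hpt]
  rw [integral_finsetSum _ fun i _ => integrable_finsetSum _ fun j _ =>
    (h.integrable_meatEntry a i j).const_mul _]
  simp only [dotProduct, Matrix.mulVec, meat, Matrix.of_apply, Finset.mul_sum]
  refine Finset.sum_congr rfl fun i _ => ?_
  rw [integral_finsetSum _ fun j _ => (h.integrable_meatEntry a i j).const_mul _]
  refine Finset.sum_congr rfl fun j _ => ?_
  rw [integral_const_mul]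
  ring

lemma posSemidef_meat (h : ProjectionModel μ P π D πbar θ πmin M) (a : Fin K) :
    (meat P πbar a (θ a)).PosSemidef := by
  refine Matrix.PosSemidef.of_dotProduct_mulVec_nonneg ?_ fun v => ?_
  · ext i j
    simp only [meat, Matrix.conjTranspose_apply, Matrix.of_apply, star_trivial]
    refine integral_congr_ae (ae_of_all _ fun z => ?_)
    simp only [meatEntry]
    ring
  · rw [star_trivial, h.dotProduct_meat_mulVec]
    exact integral_nonneg fun z =>
      mul_nonneg (inv_nonneg.2 ((πbar.mem_simplex z.1).1 a)) (sq_nonneg _)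

lemma transpose_sigmaX (P : Measure (Env d K)) : (sigmaX P)ᵀ = sigmaX P := by
  ext i j
  simp only [sigmaX, Matrix.transpose_apply, Matrix.of_apply, mul_comm]

lemma transpose_inv_sigmaX (P : Measure (Env d K)) : ((sigmaX P)⁻¹)ᵀ = (sigmaX P)⁻¹ := by
  rw [Matrix.transpose_nonsing_inv, transpose_sigmaX]

lemma asympCov_eq (a : Fin K) :
    asympCov P πbar a (θ a) = (sigmaX P)⁻¹ * meat P πbar a (θ a) * ((sigmaX P)⁻¹)ᵀ := by
  rw [transpose_inv_sigmaX]
  rfl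

lemma posSemidef_asympCov (h : ProjectionModel μ P π D πbar θ πmin M) (a : Fin K) :
    (asympCov P πbar a (θ a)).PosSemidef := by
  rw [asympCov_eq, ← Matrix.conjTranspose_eq_transpose_of_trivial]
  exact (h.posSemidef_meat a).mul_mul_conjTranspose_same _

/-- The scores are centered in every direction. -/
lemma integral_residual_mul (h : ProjectionModel μ P π D πbar θ πmin M) (a : Fin K)
    (v : Fin d → ℝ) :
    ∫ z, (z.2 a - inner ℝ z.1 (θ a)) * ∑ i, z.1 i * v i ∂P = 0 := by
  have hint : Integrable (fun z : Env d K => score z.1 (z.2 a) (θ a)) P := by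
    have h1 : Integrable (fun z : Env d K => z.2 a - inner ℝ z.1 (θ a)) P := by
      simpa using h.integrable_residual_pow a (n := 1) (by norm_num) (b := fun _ => 1)
        continuous_const
    exact h1.smul_bdd (C := M) measurable_fst.aestronglyMeasurable h.bounded
  have hz := integral_inner (𝕜 := ℝ) hint (WithLp.toLp 2 v)
  rw [h.target a, inner_zero_right] at hz
  rw [← hz]
  refine integral_congr_ae (ae_of_all _ fun z => ?_)
  simp only [score]
  rw [inner_smul_right, inner_eq_sum (WithLp.toLp 2 v)]
  congr 1
  exact Finset.sum_congr rfl fun k _ => mul_comm _ _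

/-- Law of large numbers for weighted monomials in residual and context. -/
lemma tendstoInMeasure_monomial (h : ProjectionModel μ P π D πbar θ πmin M) (a : Fin K)
    {k n : ℕ} (hk : k ≤ 1) (hn : n ≤ 2) {b : Ctx d → ℝ} (hb : Continuous b) :
    TendstoInMeasure μ (fun (T : ℕ) ω => (T : ℝ)⁻¹ * ∑ t ∈ Finset.range T,
      weight D a t ω ^ (k + 1) * ((D.Y t ω - inner ℝ (D.X t ω) (θ a)) ^ n * b (D.X t ω))) atTop
      (fun _ => ∫ z, (πbar.prob z.1 a)⁻¹ ^ k *
        ((z.2 a - inner ℝ z.1 (θ a)) ^ n * b z.1) ∂P) :=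
  h.process.tendstoInMeasure_weighted_average h.unconfounded h.pos h.le_selProb h.converges hk a
    (q := fun x => (x.2 - inner ℝ x.1 (θ a)) ^ n * b x.1)
    (Measurable.mul (by fun_prop) (hb.measurable.comp measurable_fst))
    (h.memLp_residual_pow a hn hb)

lemma gramHat_apply (D : BanditData d K Ω) (a : Fin K) (T : ℕ) (ω : Ω) (i j : Fin d) :
    gramHat D a T ω i j = (T : ℝ)⁻¹ * ∑ t ∈ Finset.range T,
      weight D a t ω * (D.X t ω i * D.X t ω j) := by
  simp [gramHat, Matrix.sum_apply, Matrix.vecMulVec_apply]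

/-- The case k = n = 0 of the weighted law: a first-power weight is unbiased, so the limit does not
involve the policy. -/
lemma tendstoInMeasure_gramHat (h : ProjectionModel μ P π D πbar θ πmin M) (a : Fin K) :
    TendstoInMeasure μ (fun (T : ℕ) ω (i j : Fin d) => gramHat D a T ω i j) atTop
      (fun _ => fun i j => sigmaX P i j) := by
  refine tendstoInMeasure_pi fun i => tendstoInMeasure_pi fun j => ?_
  have := h.tendstoInMeasure_monomial a (k := 0) (n := 0) zero_le_one (by norm_num)
    (b := fun x => x i * x j) (by fun_prop)
  simpa [gramHat_apply, sigmaX] using this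

lemma estEq_apply (D : BanditData d K Ω) (a : Fin K) (T : ℕ) (ω : Ω) (η : Ctx d) (i : Fin d) :
    estEq D a T ω η i = (T : ℝ)⁻¹ * ∑ t ∈ Finset.range T,
      weight D a t ω * ((D.Y t ω - inner ℝ (D.X t ω) η) * D.X t ω i) := by
  simp [estEq, score]

lemma tendstoInMeasure_estEq_target (h : ProjectionModel μ P π D πbar θ πmin M) (a : Fin K) :
    TendstoInMeasure μ (fun (T : ℕ) ω (i : Fin d) => estEq D a T ω (θ a) i) atTop
      (fun _ => 0) := by
  refine tendstoInMeasure_pi fun i => ?_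
  have h1 := h.tendstoInMeasure_monomial a (k := 0) (n := 1) zero_le_one (by norm_num)
    (b := fun x => x i) (by fun_prop)
  have h0 := h.integral_residual_mul a (Pi.single i 1)
  simp only [Pi.single_apply, mul_ite, mul_one, mul_zero, Finset.sum_ite_eq', Finset.mem_univ,
    if_true] at h0
  simp only [pow_zero, one_mul, pow_one, zero_add, h0] at h1
  simpa [estEq_apply] using h1

/-- The estimating function is affine in the parameter. -/
lemma estEq_sub (D : BanditData d K Ω) (a : Fin K) (T : ℕ) (ω : Ω) (η η' : Ctx d) :
    (fun i => estEq D a T ω η i - estEq D a T ω η' i) =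
      gramHat D a T ω *ᵥ fun j => η' j - η j := by
  ext i
  simp only [estEq_apply, Matrix.mulVec, dotProduct, gramHat_apply]
  rw [← mul_sub, ← Finset.sum_sub_distrib]
  have hterm : ∀ t, weight D a t ω * ((D.Y t ω - inner ℝ (D.X t ω) η) * D.X t ω i) -
      weight D a t ω * ((D.Y t ω - inner ℝ (D.X t ω) η') * D.X t ω i) =
      ∑ j, weight D a t ω * (D.X t ω i * D.X t ω j) * (η' j - η j) := by
    intro t
    have hr : inner ℝ (D.X t ω) η' - inner ℝ (D.X t ω) η =
        ∑ j, D.X t ω j * (η' j - η j) := by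
      rw [inner_eq_sum, inner_eq_sum, ← Finset.sum_sub_distrib]
      exact Finset.sum_congr rfl fun k _ => by ring
    calc _ = weight D a t ω * D.X t ω i *
          (inner ℝ (D.X t ω) η' - inner ℝ (D.X t ω) η) := by ring
      _ = _ := by
        rw [hr, Finset.mul_sum]
        exact Finset.sum_congr rfl fun k _ => by ring
  simp_rw [hterm]
  rw [Finset.sum_comm, Finset.mul_sum]
  refine Finset.sum_congr rfl fun j _ => ?_
  rw [← Finset.sum_mul, mul_assoc]

/-- The exact linearization behind both consistency and asymptotic normality; no Taylor expansion in
the parameter is involved. -/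
lemma sub_eq_inv_mulVec {D : BanditData d K Ω} {a : Fin K} {T : ℕ} {ω : Ω}
    (hG : (gramHat D a T ω).det ≠ 0) (η η' : Ctx d) :
    (fun j => η' j - η j) = (gramHat D a T ω)⁻¹ *ᵥ
      fun i => estEq D a T ω η i - estEq D a T ω η' i := by
  rw [estEq_sub, Matrix.mulVec_mulVec, Matrix.nonsing_inv_mul _ (isUnit_iff_ne_zero.2 hG),
    Matrix.one_mulVec]

/-- The estimator is G⁻¹Ψ(0), so the affine identity based at 0 gives Ψ(0) − Ψ(θ̂) = GG⁻¹Ψ(0) =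
Ψ(0). -/
lemma estEq_ipwLS {D : BanditData d K Ω} {a : Fin K} {T : ℕ} {ω : Ω}
    (hG : (gramHat D a T ω).det ≠ 0) : estEq D a T ω (ipwLS D a T ω) = 0 := by
  have h0 := estEq_sub D a T ω 0 (ipwLS D a T ω)
  have h1 : (fun j => ipwLS D a T ω j - (0 : Ctx d) j) = (gramHat D a T ω)⁻¹ *ᵥ
      fun i => estEq D a T ω 0 i := by
    ext j
    simp only [ipwLS, PiLp.zero_apply, sub_zero]
    congr 2
    ext i
    simp [score, mul_assoc]
  rw [h1, Matrix.mulVec_mulVec, Matrix.mul_nonsing_inv _ (isUnit_iff_ne_zero.2 hG),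
    Matrix.one_mulVec] at h0
  ext i
  have := congrFun h0 i
  simpa using this

/-- The weighted Gram matrix is invertible with probability tending to one. -/
lemma tendsto_measure_det_eq_zero (h : ProjectionModel μ P π D πbar θ πmin M) (a : Fin K) :
    Tendsto (fun T => μ {ω | (gramHat D a T ω).det = 0}) atTop (𝓝 0) := by
  have hdet := tendstoInMeasure_comp_continuousAt (h.tendstoInMeasure_gramHat a)
    (g := fun A : Fin d → Fin d → ℝ => (Matrix.of A).det) continuous_det_of.continuousAt
  have hne : (sigmaX P).det ≠ 0 := ((Matrix.isUnit_iff_isUnit_det _).1 h.isUnit_sigmaX).ne_zero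
  -- A zero determinant lies at distance |det Σ_X| > 0 from the limit.
  refine tendsto_of_tendsto_of_tendsto_of_le_of_le tendsto_const_nhds
    (tendstoInMeasure_iff_dist.1 hdet |(sigmaX P).det| (abs_pos.2 hne)) (fun _ => zero_le)
    fun T => measure_mono fun ω hω => ?_
  change |(sigmaX P).det| ≤ dist (gramHat D a T ω).det (sigmaX P).det
  rw [show (gramHat D a T ω).det = 0 from hω, dist_zero_left, Real.norm_eq_abs]

lemma measurable_gramHat (h : ProjectionModel μ P π D πbar θ πmin M) (a : Fin K) (T : ℕ) :
    Measurable fun ω (i j : Fin d) => gramHat D a T ω i j := by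
  refine measurable_pi_lambda _ fun i => measurable_pi_lambda _ fun j => ?_
  simp_rw [gramHat_apply]
  refine (Finset.measurable_sum _ fun t _ => ?_).const_mul _
  have hX := h.process.measurable_X t
  exact (h.process.measurable_weight a t).mul (by fun_prop)

lemma measurable_inv_gramHat (h : ProjectionModel μ P π D πbar θ πmin M) (a : Fin K) (T : ℕ)
    (i j : Fin d) : Measurable fun ω => ((gramHat D a T ω)⁻¹) i j :=
  (measurable_inv_entry i j).comp (h.measurable_gramHat a T)

lemma measurable_ipwLS (h : ProjectionModel μ P π D πbar θ πmin M) (a : Fin K) (T : ℕ) :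
    Measurable (ipwLS D a T) := by
  refine (WithLp.measurable_toLp 2 _).comp (measurable_pi_lambda _ fun i => ?_)
  simp only [Matrix.mulVec, dotProduct]
  refine Finset.measurable_sum _ fun j _ => (h.measurable_inv_gramHat a T i j).mul ?_
  simp only [Pi.smul_apply, Finset.sum_apply, smul_eq_mul]
  refine (Finset.measurable_sum _ fun t _ => ?_).const_mul _
  have hX := h.process.measurable_X t
  exact ((h.process.measurable_weight a t).mul (h.process.measurable_Y t)).mul (by fun_prop)

lemma isIPWZEstimator_ipwLS (h : ProjectionModel μ P π D πbar θ πmin M) :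
    IsIPWZEstimator μ D fun T a ω => ipwLS D a T ω := by
  refine ⟨fun T a => (h.measurable_ipwLS a T).aemeasurable, fun a => ?_⟩
  refine tendstoInMeasure_of_eq_off (f := fun _ _ => 0) ?_ (h.tendsto_measure_det_eq_zero a)
    fun T ω hω => ?_
  · intro ε hε
    simp [hε.not_ge]
  · rw [estEq_ipwLS hω, smul_zero]

end ProjectionModel

end

/-! ### Consistency, variance estimation and asymptotic normality of approximate solutions. -/

namespace ProjectionModel

variable {d K : ℕ} {Ω : Type*} [MeasurableSpace Ω]
  {μ : Measure Ω} [IsProbabilityMeasure μ] {P : Measure (Env d K)}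
  {π : BehaviorPolicy d K} {D : BanditData d K Ω} {πbar : StationaryPolicy d K}
  {θ : Fin K → Ctx d} {πmin M : ℝ} {θhat : ℕ → Fin K → Ω → Ctx d}

lemma tendstoInMeasure_sqrt_estEq (hθhat : IsIPWZEstimator μ D θhat) (a : Fin K) :
    TendstoInMeasure μ (fun (T : ℕ) ω (i : Fin d) => √(T : ℝ) * estEq D a T ω (θhat T a ω) i)
      atTop (fun _ => 0) := by
  have h := tendstoInMeasure_comp_continuousAt (hθhat.2 a)
    (g := fun (v : Ctx d) (i : Fin d) => v i) (by fun_prop)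
  exact h

lemma tendstoInMeasure_estEq_estimator (hθhat : IsIPWZEstimator μ D θhat) (a : Fin K) :
    TendstoInMeasure μ (fun (T : ℕ) ω (i : Fin d) => estEq D a T ω (θhat T a ω) i)
      atTop (fun _ => 0) := by
  have h := tendstoInMeasure_sqrt_estEq hθhat a
  rw [tendstoInMeasure_iff_norm] at h ⊢
  intro ε hε
  refine tendsto_of_tendsto_of_tendsto_of_le_of_le' tendsto_const_nhds (h ε hε)
    (Eventually.of_forall fun _ => zero_le) ?_
  filter_upwards [eventually_ge_atTop 1] with T hT
  refine measure_mono fun ω hω => ?_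
  -- For T ≥ 1 the factor √T only enlarges the norm, so dropping it keeps the convergence.
  have hsqrt : 1 ≤ √(T : ℝ) := Real.one_le_sqrt.2 (by exact_mod_cast hT)
  have heq : (fun i => √(T : ℝ) * estEq D a T ω (θhat T a ω) i) =
      √(T : ℝ) • fun i => estEq D a T ω (θhat T a ω) i := rfl
  change ε ≤ ‖(fun i => √(T : ℝ) * estEq D a T ω (θhat T a ω) i) - 0‖
  change ε ≤ ‖(fun i => estEq D a T ω (θhat T a ω) i) - 0‖ at hω
  rw [sub_zero] at hω ⊢
  rw [heq, norm_smul, Real.norm_of_nonneg (Real.sqrt_nonneg _)]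
  exact hω.trans (le_mul_of_one_le_left (norm_nonneg _) hsqrt)

lemma continuousAt_inv_mulVec {A : Fin d → Fin d → ℝ} (hA : IsUnit (Matrix.of A))
    (v : Fin d → ℝ) :
    ContinuousAt (fun x : (Fin d → Fin d → ℝ) × (Fin d → ℝ) => (Matrix.of x.1)⁻¹ *ᵥ x.2)
      (A, v) := by
  rw [continuousAt_pi]
  intro i
  simp only [Matrix.mulVec, dotProduct]
  refine tendsto_finsetSum _ fun j _ => Tendsto.mul ?_ ?_
  · exact (continuousAt_inv_entry hA i j).comp (x := (A, v)) continuousAt_fst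
  · exact ((continuous_apply j).comp continuous_snd).continuousAt

/-- Solutions of the estimating equation are consistent. -/
lemma tendstoInMeasure_estimator (h : ProjectionModel μ P π D πbar θ πmin M)
    (hθhat : IsIPWZEstimator μ D θhat) (a : Fin K) :
    TendstoInMeasure μ (fun (T : ℕ) ω (i : Fin d) => θhat T a ω i - θ a i) atTop
      (fun _ => 0) := by
  -- Ψ(θ) − Ψ(θ̂) tends to 0, and G⁻¹ stays near Σ_X⁻¹ in probability.
  have hE := tendstoInMeasure_comp_continuousAt
    (tendstoInMeasure_prodMk (h.tendstoInMeasure_estEq_target a)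
      (tendstoInMeasure_estEq_estimator hθhat a))
    (g := fun x : (Fin d → ℝ) × (Fin d → ℝ) => x.1 - x.2) (by fun_prop)
  have hlim := tendstoInMeasure_comp_continuousAt
    (tendstoInMeasure_prodMk (h.tendstoInMeasure_gramHat a) hE)
    (continuousAt_inv_mulVec h.isUnit_sigmaX _)
  simp only [sub_zero, Matrix.mulVec_zero] at hlim
  refine tendstoInMeasure_of_eq_off hlim (h.tendsto_measure_det_eq_zero a) fun T ω hω => ?_
  exact (sub_eq_inv_mulVec hω (θ a) (θhat T a ω)).symm

/-- The weighted averages that occur in the expansion of `meatHat`. -/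
def weightedMoment (D : BanditData d K Ω) (θ : Fin K → Ctx d) (a : Fin K) (n : ℕ)
    (b : Ctx d → ℝ) (T : ℕ) (ω : Ω) : ℝ :=
  (T : ℝ)⁻¹ * ∑ t ∈ Finset.range T,
    weight D a t ω ^ 2 * ((D.Y t ω - inner ℝ (D.X t ω) (θ a)) ^ n * b (D.X t ω))

/-- Obtained by squaring Y − Xᵀη = (Y − Xᵀθ) − Xᵀ(η − θ). The random parameter is thereby separated
from averages at the fixed parameter, to which the weighted law applies. -/
lemma meatHat_apply (D : BanditData d K Ω) (a : Fin K) (T : ℕ) (ω : Ω) (η : Ctx d)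
    (i j : Fin d) :
    meatHat D a T ω η i j = weightedMoment D θ a 2 (fun x => x i * x j) T ω -
      2 * ∑ k, (η k - θ a k) * weightedMoment D θ a 1 (fun x => x i * x j * x k) T ω +
      ∑ k, ∑ l, (η k - θ a k) * (η l - θ a l) *
        weightedMoment D θ a 0 (fun x => x i * x j * (x k * x l)) T ω := by
  have hpt : ∀ t, weight D a t ω ^ 2 * (D.Y t ω - inner ℝ (D.X t ω) η) ^ 2 *
      (D.X t ω i * D.X t ω j) =
      weight D a t ω ^ 2 * ((D.Y t ω - inner ℝ (D.X t ω) (θ a)) ^ 2 *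
        (D.X t ω i * D.X t ω j)) -
      2 * ∑ k, (η k - θ a k) * (weight D a t ω ^ 2 *
        ((D.Y t ω - inner ℝ (D.X t ω) (θ a)) ^ 1 * (D.X t ω i * D.X t ω j * D.X t ω k))) +
      ∑ k, ∑ l, (η k - θ a k) * (η l - θ a l) * (weight D a t ω ^ 2 *
        ((D.Y t ω - inner ℝ (D.X t ω) (θ a)) ^ 0 *
          (D.X t ω i * D.X t ω j * (D.X t ω k * D.X t ω l)))) := by
    intro t
    have hr : inner ℝ (D.X t ω) η = inner ℝ (D.X t ω) (θ a) +
        ∑ k, (η k - θ a k) * D.X t ω k := by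
      rw [inner_eq_sum, inner_eq_sum, ← Finset.sum_add_distrib]
      exact Finset.sum_congr rfl fun k _ => by ring
    have h1 : ∑ k, (η k - θ a k) * (weight D a t ω ^ 2 *
        ((D.Y t ω - inner ℝ (D.X t ω) (θ a)) ^ 1 * (D.X t ω i * D.X t ω j * D.X t ω k))) =
        weight D a t ω ^ 2 * (D.Y t ω - inner ℝ (D.X t ω) (θ a)) *
          (D.X t ω i * D.X t ω j) * ∑ k, (η k - θ a k) * D.X t ω k := by
      rw [Finset.mul_sum]
      exact Finset.sum_congr rfl fun k _ => by ring
    have h2 : ∑ k, ∑ l, (η k - θ a k) * (η l - θ a l) * (weight D a t ω ^ 2 *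
        ((D.Y t ω - inner ℝ (D.X t ω) (θ a)) ^ 0 *
          (D.X t ω i * D.X t ω j * (D.X t ω k * D.X t ω l)))) =
        weight D a t ω ^ 2 * (D.X t ω i * D.X t ω j) *
          ((∑ k, (η k - θ a k) * D.X t ω k) * ∑ k, (η k - θ a k) * D.X t ω k) := by
      rw [Finset.sum_mul_sum, Finset.mul_sum]
      refine Finset.sum_congr rfl fun k _ => ?_
      rw [Finset.mul_sum]
      exact Finset.sum_congr rfl fun l _ => by ring
    rw [h1, h2, hr]
    ring
  have hL : meatHat D a T ω η i j = (T : ℝ)⁻¹ * ∑ t ∈ Finset.range T,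
      weight D a t ω ^ 2 * (D.Y t ω - inner ℝ (D.X t ω) η) ^ 2 * (D.X t ω i * D.X t ω j) := by
    simp [meatHat, Matrix.sum_apply, Matrix.vecMulVec_apply]
  rw [hL]
  simp_rw [hpt]
  rw [Finset.sum_add_distrib, Finset.sum_sub_distrib, mul_add, mul_sub]
  congr 1
  · congr 1
    rw [← Finset.mul_sum, Finset.sum_comm, mul_left_comm, Finset.mul_sum (a := (T : ℝ)⁻¹)]
    congr 1
    refine Finset.sum_congr rfl fun k _ => ?_
    rw [weightedMoment, ← Finset.mul_sum, mul_left_comm]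
  · rw [Finset.sum_comm, Finset.mul_sum]
    refine Finset.sum_congr rfl fun k _ => ?_
    rw [Finset.sum_comm, Finset.mul_sum]
    refine Finset.sum_congr rfl fun l _ => ?_
    rw [weightedMoment, ← Finset.mul_sum, mul_left_comm]

lemma tendstoInMeasure_meatHat (h : ProjectionModel μ P π D πbar θ πmin M)
    (hθhat : IsIPWZEstimator μ D θhat) (a : Fin K) :
    TendstoInMeasure μ (fun (T : ℕ) ω (i j : Fin d) => meatHat D a T ω (θhat T a ω) i j) atTop
      (fun _ => fun i j => meat P πbar a (θ a) i j) := by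
  refine tendstoInMeasure_pi fun i => tendstoInMeasure_pi fun j => ?_
  have h0 := h.tendstoInMeasure_monomial a (k := 1) (n := 2) le_rfl le_rfl
    (b := fun x => x i * x j) (by fun_prop)
  have h1 := tendstoInMeasure_pi (f := fun (T : ℕ) ω (k : Fin d) =>
      weightedMoment D θ a 1 (fun x => x i * x j * x k) T ω) fun k =>
    h.tendstoInMeasure_monomial a (k := 1) (n := 1) le_rfl (by norm_num)
      (b := fun x => x i * x j * x k) (by fun_prop)
  have h2 := tendstoInMeasure_pi (f := fun (T : ℕ) ω (k l : Fin d) =>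
      weightedMoment D θ a 0 (fun x => x i * x j * (x k * x l)) T ω) fun k =>
    tendstoInMeasure_pi fun l =>
      h.tendstoInMeasure_monomial a (k := 1) (n := 0) le_rfl (by norm_num)
        (b := fun x => x i * x j * (x k * x l)) (by fun_prop)
  -- The linear and quadratic terms die out: their moments converge and the estimation error tends
  -- to 0.
  have hall := tendstoInMeasure_comp_continuousAt
    (tendstoInMeasure_prodMk h0 (tendstoInMeasure_prodMk h1
      (tendstoInMeasure_prodMk h2 (h.tendstoInMeasure_estimator hθhat a))))
    (g := fun x : ℝ × (Fin d → ℝ) × (Fin d → Fin d → ℝ) × (Fin d → ℝ) =>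
      x.1 - 2 * ∑ k, x.2.2.2 k * x.2.1 k + ∑ k, ∑ l, x.2.2.2 k * x.2.2.2 l * x.2.2.1 k l)
    (by fun_prop)
  simp only [Pi.zero_apply, zero_mul, Finset.sum_const_zero, mul_zero, sub_zero, add_zero] at hall
  have hlim : ∫ z, (πbar.prob z.1 a)⁻¹ ^ 1 *
      ((z.2 a - inner ℝ z.1 (θ a)) ^ 2 * (z.1 i * z.1 j)) ∂P = meat P πbar a (θ a) i j := by
    simp only [pow_one, meat, Matrix.of_apply]
    exact integral_congr_ae (ae_of_all _ fun z => (meatEntry_eq a i j z).symm)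
  rw [hlim] at hall
  refine hall.congr_left fun T => ae_of_all _ fun ω => ?_
  exact (meatHat_apply D a T ω _ i j).symm

/-- Consistency of the plug-in variance estimator. -/
lemma tendstoInMeasure_covHat (h : ProjectionModel μ P π D πbar θ πmin M)
    (hθhat : IsIPWZEstimator μ D θhat) (a : Fin K) (i j : Fin d) :
    TendstoInMeasure μ (fun (T : ℕ) ω => covHat D a T ω (θhat T a ω) i j) atTop
      (fun _ => asympCov P πbar a (θ a) i j) := by
  have hA : IsUnit (Matrix.of fun i j => sigmaX P i j) := h.isUnit_sigmaX
  have hcont : ContinuousAt (fun x : (Fin d → Fin d → ℝ) × (Fin d → Fin d → ℝ) =>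
      ((Matrix.of x.1)⁻¹ * Matrix.of x.2 * ((Matrix.of x.1)⁻¹)ᵀ) i j)
      ((fun i j => sigmaX P i j), fun i j => meat P πbar a (θ a) i j) := by
    have hinv : ∀ k l, ContinuousAt (fun x : (Fin d → Fin d → ℝ) × (Fin d → Fin d → ℝ) =>
        ((Matrix.of x.1)⁻¹) k l)
        ((fun i j => sigmaX P i j), fun i j => meat P πbar a (θ a) i j) := fun k l =>
      ContinuousAt.comp (f := Prod.fst)
        (g := fun A : Fin d → Fin d → ℝ => ((Matrix.of A)⁻¹) k l)
        (continuousAt_inv_entry hA k l) continuousAt_fst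
    simp only [Matrix.mul_apply, Matrix.transpose_apply, Matrix.of_apply]
    refine tendsto_finsetSum _ fun k _ => Tendsto.mul
      (tendsto_finsetSum _ fun l _ => Tendsto.mul (hinv i l) ?_) (hinv j k)
    exact Continuous.continuousAt (by fun_prop)
  have hlim := tendstoInMeasure_comp_continuousAt
    (tendstoInMeasure_prodMk (h.tendstoInMeasure_gramHat a) (h.tendstoInMeasure_meatHat hθhat a))
    hcont
  rw [asympCov_eq]
  exact hlim

/-- The linear part of the normalized estimation error. -/
def leadingTerm (P : Measure (Env d K)) (D : BanditData d K Ω) (θ : Fin K → Ctx d) (T : ℕ)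
    (ω : Ω) : EuclideanSpace ℝ (Fin d × Fin K) :=
  WithLp.toLp 2 fun x =>
    ((sigmaX P)⁻¹ *ᵥ fun j => √(T : ℝ) * estEq D x.2 T ω (θ x.2) j) x.1

lemma measurable_estEq (h : ProjectionModel μ P π D πbar θ πmin M) (a : Fin K) (T : ℕ)
    (η : Ctx d) (j : Fin d) : Measurable fun ω => estEq D a T ω η j := by
  simp_rw [estEq_apply]
  refine (Finset.measurable_sum _ fun t _ => ?_).const_mul _
  have hX := h.process.measurable_X t
  have hY := h.process.measurable_Y t
  exact (h.process.measurable_weight a t).mul (by fun_prop)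

lemma measurable_leadingTerm (h : ProjectionModel μ P π D πbar θ πmin M) (T : ℕ) :
    Measurable (leadingTerm P D θ T) := by
  refine (WithLp.measurable_toLp 2 _).comp (measurable_pi_lambda _ fun x => ?_)
  simp only [Matrix.mulVec, dotProduct]
  exact Finset.measurable_sum _ fun j _ =>
    ((h.measurable_estEq x.2 T (θ x.2) j).const_mul _).const_mul _

lemma dotProduct_blockDiagonal_mulVec (B : Fin K → Matrix (Fin d) (Fin d) ℝ)
    (u : Fin d × Fin K → ℝ) :
    u ⬝ᵥ (Matrix.blockDiagonal B *ᵥ u) =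
      ∑ a, (fun i => u (i, a)) ⬝ᵥ (B a *ᵥ fun i => u (i, a)) := by
  simp only [dotProduct, Matrix.mulVec, Matrix.blockDiagonal_apply, Fintype.sum_prod_type,
    ite_mul, zero_mul, Finset.sum_ite_eq, Finset.mem_univ, if_true]
  rw [Finset.sum_comm]

lemma posSemidef_blockDiagonal {B : Fin K → Matrix (Fin d) (Fin d) ℝ}
    (hB : ∀ a, (B a).PosSemidef) : (Matrix.blockDiagonal B).PosSemidef := by
  refine Matrix.PosSemidef.of_dotProduct_mulVec_nonneg ?_ fun u => ?_
  · rw [Matrix.IsHermitian, Matrix.blockDiagonal_conjTranspose]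
    exact congrArg _ (funext fun a => (hB a).1)
  · rw [star_trivial, dotProduct_blockDiagonal_mulVec]
    refine Finset.sum_nonneg fun a _ => ?_
    have := (hB a).dotProduct_mulVec_nonneg (fun i => u (i, a))
    rwa [star_trivial] at this

/-- Every projection of the stacked vector is a scalar weighted sum of the kind treated by the
central limit theorem, with the arm-wise direction Σ_X⁻ᵀu_a. -/
lemma inner_leadingTerm (T : ℕ) (ω : Ω) (u : EuclideanSpace ℝ (Fin d × Fin K)) :
    inner ℝ (leadingTerm P D θ T ω) u = (√(T : ℝ))⁻¹ * ∑ t ∈ Finset.range T,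
      ∑ a, weight D a t ω * ((D.Y t ω - inner ℝ (D.X t ω) (θ a)) *
        ∑ i, D.X t ω i * (((sigmaX P)⁻¹)ᵀ *ᵥ fun j => u (j, a)) i) := by
  -- At T = 0 both sides are 0 by the convention for inverses.
  have hsqrt : √(T : ℝ) * (T : ℝ)⁻¹ = (√(T : ℝ))⁻¹ := by
    rw [← div_eq_mul_inv, Real.sqrt_div_self]
  have hin : inner ℝ (leadingTerm P D θ T ω) u =
      ∑ a, ((sigmaX P)⁻¹ *ᵥ fun j => √(T : ℝ) * estEq D a T ω (θ a) j) ⬝ᵥ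
        fun i => u (i, a) := by
    rw [PiLp.inner_apply, Fintype.sum_prod_type_right]
    simp [leadingTerm, dotProduct, mul_comm]
  have hdot : ∀ a, ((sigmaX P)⁻¹ *ᵥ fun j => √(T : ℝ) * estEq D a T ω (θ a) j) ⬝ᵥ
      (fun i => u (i, a)) =
      ∑ i, (√(T : ℝ) * estEq D a T ω (θ a) i) *
        (((sigmaX P)⁻¹)ᵀ *ᵥ fun j => u (j, a)) i := by
    intro a
    rw [dotProduct_comm, Matrix.dotProduct_mulVec, dotProduct_comm, ← Matrix.mulVec_transpose]
    rfl
  rw [hin]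
  simp_rw [hdot, estEq_apply, ← hsqrt]
  rw [mul_assoc, Finset.sum_comm (s := Finset.range T), Finset.mul_sum, Finset.mul_sum]
  refine Finset.sum_congr rfl fun a _ => ?_
  simp_rw [mul_assoc, ← Finset.mul_sum, Finset.sum_mul, Finset.mul_sum]
  rw [Finset.sum_comm]
  refine Finset.sum_congr rfl fun t _ => Finset.sum_congr rfl fun i _ => by ring

/-- Asymptotic normality of the linear part. -/
lemma tendstoInDistribution_leadingTerm (h : ProjectionModel μ P π D πbar θ πmin M) :
    TendstoInDistribution (fun T ω => leadingTerm P D θ T ω) atTop id (fun _ => μ)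
      (multivariateGaussian 0
        (Matrix.blockDiagonal fun a => asympCov P πbar a (θ a))) := by
  refine ⟨fun T => (h.measurable_leadingTerm T).aemeasurable, aemeasurable_id, ?_⟩
  refine ProbabilityMeasure.tendsto_of_tendsto_charFun fun u => ?_
  simp only [ProbabilityMeasure.coe_mk, Measure.map_id]
  rw [charFun_multivariateGaussian (posSemidef_blockDiagonal h.posSemidef_asympCov),
    dotProduct_blockDiagonal_mulVec]
  set v : Fin K → Fin d → ℝ := fun a => ((sigmaX P)⁻¹)ᵀ *ᵥ fun j => u (j, a) with hv
  have hclt := h.process.tendsto_integral_cexp_weighted_sum h.unconfounded h.pos h.le_selProb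
    h.converges
    (q := fun a x => (x.2 - inner ℝ x.1 (θ a)) * ∑ i, x.1 i * v a i)
    (fun a => by fun_prop)
    (fun a => by
      have := h.integrable_residual_pow a (n := 4) le_rfl
        (b := fun x => (∑ i, x i * v a i) ^ 4) (by fun_prop)
      simpa only [mul_pow] using this)
    (fun a => h.integral_residual_mul a (v a))
  -- With v_a = Σ_X⁻ᵀu_a, the quadratic form of the middle matrix at v_a is that of the sandwich at
  -- u_a.
  have hvar : ∑ a, ∫ z, (πbar.prob z.1 a)⁻¹ *
      ((z.2 a - inner ℝ z.1 (θ a)) * ∑ i, z.1 i * v a i) ^ 2 ∂P =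
      ∑ a, (fun i => u (i, a)) ⬝ᵥ (asympCov P πbar a (θ a) *ᵥ fun i => u (i, a)) := by
    refine Finset.sum_congr rfl fun a _ => ?_
    rw [← h.dotProduct_meat_mulVec a (v a), asympCov_eq, ← Matrix.mulVec_mulVec,
      ← Matrix.mulVec_mulVec, Matrix.dotProduct_mulVec (fun i => u (i, a)),
      ← Matrix.mulVec_transpose]
  simp only at hclt
  rw [hvar] at hclt
  convert hclt using 1
  · ext T
    rw [charFun_apply, integral_map (h.measurable_leadingTerm T).aemeasurable
      (by fun_prop)]
    simp_rw [inner_leadingTerm]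
    rfl
  · rw [inner_zero_right]
    push_cast
    congr 2
    ring

/-- Asymptotic normality of all solutions of the estimating equation. -/
lemma tendstoInDistribution_estimator (h : ProjectionModel μ P π D πbar θ πmin M)
    (hθhat : IsIPWZEstimator μ D θhat) :
    TendstoInDistribution
      (fun (T : ℕ) ω => √(T : ℝ) • (stack (fun a => θhat T a ω) - stack θ)) atTop id
      (fun _ => μ)
      (multivariateGaussian 0 (Matrix.blockDiagonal fun a => asympCov P πbar a (θ a))) := by
  -- On invertible Gram matrices √T(θ̂ − θ) = H(L − R), where L is `leadingTerm`, H = G⁻¹Σ_X tends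
  -- to the identity, and R = Σ_X⁻¹√TΨ(θ̂) tends to 0 by the estimating equation.
  set H : ℕ → Ω → Fin K → Fin d → Fin d → ℝ := fun T ω a i j =>
    ((gramHat D a T ω)⁻¹ * sigmaX P) i j with hHdef
  set R : ℕ → Ω → Fin d × Fin K → ℝ := fun T ω x =>
    ((sigmaX P)⁻¹ *ᵥ fun j => √(T : ℝ) * estEq D x.2 T ω (θhat T x.2 ω) j) x.1 with hRdef
  have hdet : IsUnit (sigmaX P).det := (Matrix.isUnit_iff_isUnit_det _).1 h.isUnit_sigmaX
  have hH : TendstoInMeasure μ H atTop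
      (fun _ => fun _ i j => (1 : Matrix (Fin d) (Fin d) ℝ) i j) := by
    refine tendstoInMeasure_pi fun a => tendstoInMeasure_pi fun i => tendstoInMeasure_pi
      fun j => ?_
    have hA : IsUnit (Matrix.of fun i j => sigmaX P i j) := h.isUnit_sigmaX
    have := tendstoInMeasure_comp_continuousAt (h.tendstoInMeasure_gramHat a)
      (g := fun A : Fin d → Fin d → ℝ => ((Matrix.of A)⁻¹ * sigmaX P) i j) (by
        simp only [Matrix.mul_apply]
        exact tendsto_finsetSum _ fun k _ =>
          Tendsto.mul (continuousAt_inv_entry hA i k) tendsto_const_nhds)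
    rw [← Matrix.nonsing_inv_mul _ hdet]
    exact this
  have hR : TendstoInMeasure μ R atTop (fun _ => 0) := by
    refine tendstoInMeasure_pi fun x => ?_
    have := tendstoInMeasure_comp_continuousAt (tendstoInMeasure_sqrt_estEq hθhat x.2)
      (g := fun w : Fin d → ℝ => ((sigmaX P)⁻¹ *ᵥ w) x.1) (by
        simp only [Matrix.mulVec, dotProduct]
        exact Continuous.continuousAt (by fun_prop))
    rw [Matrix.mulVec_zero] at this
    exact this
  have hHm : ∀ T, Measurable (H T) := fun T => by
    refine measurable_pi_lambda _ fun a => measurable_pi_lambda _ fun i =>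
      measurable_pi_lambda _ fun j => ?_
    simp only [hHdef, Matrix.mul_apply]
    exact Finset.measurable_sum _ fun k _ => (h.measurable_inv_gramHat a T i k).mul_const _
  have hθm : ∀ T a (i : Fin d), AEMeasurable (fun ω => θhat T a ω i) μ := fun T a i =>
    (by fun_prop : Measurable fun v : Ctx d => v i).comp_aemeasurable (hθhat.1 T a)
  have hRm : ∀ T, AEMeasurable (R T) μ := fun T => by
    refine aemeasurable_pi_lambda _ fun x => ?_
    simp only [hRdef, Matrix.mulVec, dotProduct]
    refine Finset.aemeasurable_fun_sum _ fun j _ => AEMeasurable.const_mul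
      (AEMeasurable.const_mul ?_ _) _
    simp_rw [estEq_apply]
    refine (Finset.aemeasurable_fun_sum _ fun t _ => ?_).const_mul _
    have hX := h.process.measurable_X t
    have hXθ : AEMeasurable (fun ω => inner ℝ (D.X t ω) (θhat T x.2 ω)) μ :=
      hX.aemeasurable.inner (hθhat.1 T x.2)
    exact (h.process.measurable_weight x.2 t).aemeasurable.mul
      (((h.process.measurable_Y t).aemeasurable.sub hXθ).mul
        (by fun_prop : Measurable fun ω => D.X t ω j).aemeasurable)
  set g : EuclideanSpace ℝ (Fin d × Fin K) ×
      ((Fin K → Fin d → Fin d → ℝ) × (Fin d × Fin K → ℝ)) → EuclideanSpace ℝ (Fin d × Fin K) :=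
    fun x => WithLp.toLp 2 fun y => ∑ j, x.2.1 y.2 y.1 j * (x.1 (j, y.2) - x.2.2 (j, y.2))
    with hg
  have hgc : Continuous g := by
    refine (PiLp.continuous_toLp 2 _).comp (continuous_pi fun y => ?_)
    fun_prop
  -- Slutsky's theorem for `g`, which is the map (L, (H, R)) ↦ H(L − R) arm by arm; at the limit (1,
  -- 0) of (H, R) it is the identity.
  have hslutsky := h.tendstoInDistribution_leadingTerm.continuous_comp_prodMk_of_tendstoInMeasure_const
    hgc (tendstoInMeasure_prodMk hH hR) (fun T => (hHm T).aemeasurable.prodMk (hRm T))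
  have hid : (fun ω => g (id ω, ((fun _ i j => (1 : Matrix (Fin d) (Fin d) ℝ) i j), 0))) = id := by
    funext v
    ext y
    simp [hg, Matrix.one_apply]
  rw [hid] at hslutsky
  refine tendstoInDistribution_of_tendstoInMeasure_sub _ _ hslutsky ?_ fun T => ?_
  -- The two sequences agree unless some arm has a singular Gram matrix, and there are finitely many
  -- arms.
  · have hB : Tendsto (fun T => μ (⋃ a : Fin K, {ω | (gramHat D a T ω).det = 0})) atTop
        (𝓝 0) := by
      have hsum := tendsto_finsetSum (Finset.univ : Finset (Fin K))
        fun a (_ : a ∈ Finset.univ) => h.tendsto_measure_det_eq_zero a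
      rw [Finset.sum_const_zero] at hsum
      exact tendsto_of_tendsto_of_tendsto_of_le_of_le tendsto_const_nhds hsum
        (fun _ => zero_le) fun T => measure_iUnion_fintype_le μ _
    refine tendstoInMeasure_of_eq_off (f := fun _ _ => 0) ?_ hB fun T ω hω => ?_
    · intro ε hε
      simp [hε.not_ge]
    · simp only [Set.mem_iUnion, not_exists] at hω
      rw [Pi.sub_apply, Pi.sub_apply, eq_comm, sub_eq_zero]
      ext y
      have hy : (gramHat D y.2 T ω).det ≠ 0 := hω y.2
      have hdiff := congrFun (sub_eq_inv_mulVec hy (θ y.2) (θhat T y.2 ω)) y.1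
      simp only at hdiff
      have hL : (√(T : ℝ) • (stack (fun a => θhat T a ω) - stack θ)) y =
          √(T : ℝ) * (θhat T y.2 ω y.1 - θ y.2 y.1) := by
        simp [stack]
      have hRHS : g (leadingTerm P D θ T ω, (H T ω, R T ω)) y =
          (((gramHat D y.2 T ω)⁻¹ * sigmaX P) *ᵥ ((sigmaX P)⁻¹ *ᵥ fun j =>
            √(T : ℝ) * (estEq D y.2 T ω (θ y.2) j - estEq D y.2 T ω (θhat T y.2 ω) j))) y.1 := by
        have hsplit : (fun j => √(T : ℝ) *
            (estEq D y.2 T ω (θ y.2) j - estEq D y.2 T ω (θhat T y.2 ω) j)) =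
            (fun j => √(T : ℝ) * estEq D y.2 T ω (θ y.2) j) -
            fun j => √(T : ℝ) * estEq D y.2 T ω (θhat T y.2 ω) j := by
          ext j
          simp [mul_sub]
        rw [hsplit, Matrix.mulVec_sub]
        rfl
      rw [hL, hRHS, Matrix.mulVec_mulVec, Matrix.mul_assoc, Matrix.mul_nonsing_inv _ hdet,
        Matrix.mul_one, hdiff]
      simp only [Matrix.mulVec, dotProduct, Finset.mul_sum]
      exact Finset.sum_congr rfl fun j _ => by ring
  · have : AEMeasurable (fun ω => stack fun a => θhat T a ω) μ :=
      (WithLp.measurable_toLp 2 _).comp_aemeasurable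
        (aemeasurable_pi_lambda _ fun y => hθm T y.2 y.1)
    exact (this.sub aemeasurable_const).const_smul (√(T : ℝ))

end ProjectionModel

end AdaptiveBandit

end

theorem corollary1 {d K : ℕ} {Ω : Type*} [MeasurableSpace Ω] (μ : Measure Ω)
    [IsProbabilityMeasure μ] (P : Measure (AdaptiveBandit.Env d K))
    (π : AdaptiveBandit.BehaviorPolicy d K) (D : AdaptiveBandit.BanditData d K Ω)
    (hD : AdaptiveBandit.IsBanditProcess μ P π D)
    (hunc : AdaptiveBandit.Unconfounded μ D)
    (θ : Fin K → AdaptiveBandit.Ctx d) (hθ : AdaptiveBandit.IsTarget P θ)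
    (hX : ∃ M : ℝ, ∀ᵐ z ∂P, ‖z.1‖ ≤ M)
    (hSigma : IsUnit (AdaptiveBandit.sigmaX P))
    (hY : ∀ a, Integrable (fun z : AdaptiveBandit.Env d K => z.2 a ^ 4) P)
    (πbar : AdaptiveBandit.StationaryPolicy d K)
    (hconv : AdaptiveBandit.PolicyConverges μ π D πbar)
    (hmin : AdaptiveBandit.MinSampling μ π D) :
    (∀ a i j, Integrable (AdaptiveBandit.meatEntry πbar a (θ a) i j) P) ∧
    (∀ a, (AdaptiveBandit.asympCov P πbar a (θ a)).PosSemidef) ∧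
    AdaptiveBandit.IsIPWZEstimator μ D (fun T a ω => AdaptiveBandit.ipwLS D a T ω) ∧
    ∀ θhat : ℕ → Fin K → Ω → AdaptiveBandit.Ctx d,
      AdaptiveBandit.IsIPWZEstimator μ D θhat →
        TendstoInDistribution
          (fun (T : ℕ) ω =>
            √(T : ℝ) • (AdaptiveBandit.stack (fun a => θhat T a ω) - AdaptiveBandit.stack θ))
          atTop id (fun _ => μ)
          (multivariateGaussian 0
            (Matrix.blockDiagonal fun a => AdaptiveBandit.asympCov P πbar a (θ a))) ∧
        ∀ a i j, TendstoInMeasure μ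
          (fun (T : ℕ) ω => AdaptiveBandit.covHat D a T ω (θhat T a ω) i j) atTop
          (fun _ => AdaptiveBandit.asympCov P πbar a (θ a) i j) := by
  obtain ⟨M, hM⟩ := hX
  obtain ⟨πmin, hpos, -, hle⟩ := hmin
  have h : AdaptiveBandit.ProjectionModel μ P π D πbar θ πmin M :=
    ⟨hD, hunc, hθ, hpos, hle, hconv, hM, hSigma, hY⟩
  exact ⟨fun a i j => h.integrable_meatEntry a i j, h.posSemidef_asympCov,
    h.isIPWZEstimator_ipwLS, fun θhat hθhat =>
      ⟨h.tendstoInDistribution_estimator hθhat,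
        fun a i j => h.tendstoInMeasure_covHat hθhat a i j⟩⟩
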